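/- **The model.** Time is divided into slots; each slot consists of a slot on a data channel and a slot on a control channel. An adaptive adversary decides in each slot, as an arbitrary function of everything that happened in the earlier slots (but not of the random choices of the present slot), which packets are injected at the beginning of the slot and which of the two channels are disrupted. A packet is *live* from its injection until its successful transmission; only slots with at least one live packet belong to the execution, and all other slots are ignored. A channel is *empty* in a slot if nothing is sent on it and it is not disrupted. A packet is transmitted successfully in a slot if it is the only packet broadcast on the data channel and the data channel is not disrupted. **The protocol Re-Backoff** with constant $c>0$. An injected packet is at first inactive. If the control channel is empty in a slot, every packet that is inactive in this slot becomes active in the next slot. In the $s$-th slot ($s\ge 1$) of an active period a packet, independently of all other random choices, sends a busy tone on the control channel with probability $\min\{1,\,c\max\{\ln s,1\}/s\}$ and broadcasts itself on the data channel with probability $\frac{1}{2s}$. If the broadcast is successful, the packet terminates. Otherwise, if at least $\frac{15}{16}s$ of the $s$ data slots of the active period have been empty, the packet becomes inactive, starting with the next slot. A slot of the execution is *disrupted* if the adversary disrupts at least one of the two channels in it, and *wasted* if it is not disrupted and either no packet or more than one packet is broadcast on the data channel in it. Let $D$ be the (random) number of disrupted slots, let the *waste* be the fraction of the slots of the execution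 that are wasted, and let $A_u$ be the number of access attempts of packet $u$, that is, the number of its broadcasts on the data channel plus the number of its busy tones on the control channel. **Theorem.** For every constant $c>0$ there are constants $\varepsilon>0$ and $C$, depending only on $c$, such that the following holds for every $n\ge 1$ and every adaptive adversary that almost surely injects each of $n$ packets at some time and almost surely disrupts only finitely many slots of the execution. ($n$ is fixed in advance and unknown to the packets.) Almost surely all $n$ packets are transmitted successfully (so the execution is finite), and $$\mathbb E[\text{waste}]\le 1-\varepsilon ,\qquad \mathbb E[A_u]\le C\cdot\mathbb E\big[\log^2(n+D+1)\big]\quad\text{for every packet }u .$$ In particular, if the adversary never disrupts more than $D_0$ slots, then $\mathbb E[A_u]\le C\log^2(n+D_0+1)$. -/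

import Mathlib

open MeasureTheory
open scoped ENNReal NNReal unitInterval

noncomputable section

namespace ReBackoff

/-- The local state of a packet at the beginning of a slot.
* `pending`: not yet injected by the adversary;
* `inactive`: injected and live, but inactive;
* `active s e`: active; the present slot is the `s`-th slot of the present active period
  (so `s ≥ 1` is the age of the packet in this slot), and `e` of the previous `s - 1` data slots of
  this period were empty;
* `done`: the packet has been transmitted successfully and has terminated. -/
inductive Status where
  | pending : Status
  | inactive : Status
  | active (s e : ℕ) : Status
  | done : Status

/-- A packet is live from its injection until its successful transmission. -/
def Status.IsLive : Status → Prop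
  | .pending => False
  | .inactive => True
  | .active _ _ => True
  | .done => False

/-- Probability of sending on the data channel: `d / s` with `d = 1/2` at age `s`. -/
def Status.dataProb : Status → ℝ
  | .active s _ => (1 / 2) / (s : ℝ)
  | _ => 0

/-- Probability of sending the busy tone on the control channel: `c max(ln s, 1) / s` at age `s`,
truncated at `1`. -/
def Status.controlProb (c : ℝ) : Status → ℝ
  | .active s _ => min 1 (c * max (Real.log s) 1 / (s : ℝ))
  | _ => 0

/-- The joint state of the `n` packets. -/
abbrev State (n : ℕ) := Fin n → Status

/-- What happens in a slot: which packets broadcast on the data channel, and which on the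
control channel. -/
structure SlotRecord (n : ℕ) where
  data : Finset (Fin n)
  control : Finset (Fin n)

/-- What the adversary decides for a slot: which packets are injected at its beginning (packets
that were injected before are not affected), and which of the two channels are disrupted. -/
structure Decision (n : ℕ) where
  inject : Finset (Fin n)
  jamData : Bool
  jamControl : Bool

/-- An adaptive adversary: the decision for a slot is an arbitrary function of everything that
happened in the earlier slots (the list of their records, most recent slot first), but not of the
random choices made in the slot itself. -/
abbrev Adversary (n : ℕ) := List (SlotRecord n) → Decision n

/-- The random numbers used in one slot: for each packet one for the data channel and one for the
control channel. -/
abbrev SlotCoins (n : ℕ) := Fin n → I × I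

/-- The random numbers used in all the slots `0, 1, 2, …`. -/
abbrev Coins (n : ℕ) := ℕ → SlotCoins n

/-- All the random numbers are independent and uniform on `[0, 1]`. -/
def coinMeasure (n : ℕ) : Measure (Coins n) :=
  Measure.infinitePi (fun _ : ℕ => (volume : Measure (SlotCoins n)))

section Slot

variable {n : ℕ}

open Classical in
/-- The state after the injections at the beginning of a slot. -/
def arrive (st : State n) (dec : Decision n) : State n := fun u =>
  match st u with
  | .pending => if u ∈ dec.inject then .inactive else .pending
  | other => other

open Classical in
/-- The packets that broadcast on either channel in a slot, given the state (after the injections)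
and the random numbers. -/
def broadcasts (c : ℝ) (st : State n) (x : SlotCoins n) : SlotRecord n where
  data := Finset.univ.filter fun u => ((x u).1 : ℝ) < (st u).dataProb
  control := Finset.univ.filter fun u => ((x u).2 : ℝ) < (st u).controlProb c

/-- The data slot is empty: no broadcast and no disruption on the data channel. -/
def DataEmpty (dec : Decision n) (r : SlotRecord n) : Prop :=
  dec.jamData = false ∧ r.data = ∅

/-- The control slot is empty: no busy tone and no disruption on the control channel. -/
def ControlEmpty (dec : Decision n) (r : SlotRecord n) : Prop :=
  dec.jamControl = false ∧ r.control = ∅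

/-- Packet `u` is transmitted successfully: it is the only packet that is broadcast on the data
channel, and the data channel is not disrupted. -/
def Succeeds (dec : Decision n) (r : SlotRecord n) (u : Fin n) : Prop :=
  dec.jamData = false ∧ r.data = {u}

open Classical in
/-- The protocol: the state of the packets at the end of a slot. A packet that is active and is not
successful becomes inactive when at least a `15/16`-fraction of the data slots of its present
active period (including the present slot) have been empty. An inactive packet becomes active in
the next slot when the control slot is empty. -/
def step (dec : Decision n) (st : State n) (r : SlotRecord n) : State n := fun u =>
  match st u with
  | .pending => .pending
  | .inactive => if ControlEmpty dec r then .active 1 0 else .inactive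
  | .active s e =>
      if Succeeds dec r u then .done
      else
        let e' := if DataEmpty dec r then e + 1 else e
        if (15 / 16 : ℝ) * s ≤ e' then .inactive else .active (s + 1) e'
  | .done => .done

end Slot

section Execution

variable {n : ℕ} (c : ℝ) (A : Adversary n) (ω : Coins n)

/-- The state at the beginning of slot `t` (before its injections), and the records of the slots
before `t`, most recent first. -/
def config : ℕ → State n × List (SlotRecord n)
  | 0 => (fun _ => .pending, [])
  | t + 1 =>
      let st := (config t).1
      let hist := (config t).2
      let dec := A hist
      let r := broadcasts c (arrive st dec) (ω t)
      (step dec (arrive st dec) r, r :: hist)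

/-- The state of packet `u` at the beginning of slot `t`, before the injections of slot `t`. -/
def statusAt (t : ℕ) (u : Fin n) : Status := (config c A ω t).1 u

/-- The decision of the adversary for slot `t`. -/
def decisionAt (t : ℕ) : Decision n := A (config c A ω t).2

/-- The state during slot `t`, after the injections of slot `t`. -/
def slotState (t : ℕ) : State n := arrive (config c A ω t).1 (decisionAt c A ω t)

/-- The broadcasts of slot `t`. -/
def recordAt (t : ℕ) : SlotRecord n := broadcasts c (slotState c A ω t) (ω t)

/-- The slots of the execution: those in which at least one packet is live. -/
def liveSlots : Set ℕ := {t | ∃ u, (slotState c A ω t u).IsLive}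

/-- The slots of the execution in which the adversary disrupts at least one of the channels. -/
def disruptedSlots : Set ℕ :=
  {t | t ∈ liveSlots c A ω ∧
    ((decisionAt c A ω t).jamData = true ∨ (decisionAt c A ω t).jamControl = true)}

/-- The wasted slots of the execution: those that are not disrupted and in which either no packet
(empty slot) or more than one packet (collision) is broadcast on the data channel. -/
def wastedSlots : Set ℕ :=
  {t | t ∈ liveSlots c A ω ∧ t ∉ disruptedSlots c A ω ∧
    ((recordAt c A ω t).data = ∅ ∨ 1 < (recordAt c A ω t).data.card)}

/-- The waste of the execution: the fraction of its slots that are wasted. -/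
def waste : ℝ := ((wastedSlots c A ω).ncard : ℝ) / ((liveSlots c A ω).ncard : ℝ)

/-- The number of disrupted slots. -/
def numDisrupted : ℕ := (disruptedSlots c A ω).ncard

open Classical in
/-- The number of access attempts of packet `u`: its broadcasts on the data channel and on the
control channel, over all the slots. -/
def attempts (u : Fin n) : ℝ≥0∞ :=
  ∑' t : ℕ, ((if u ∈ (recordAt c A ω t).data then 1 else 0)
    + (if u ∈ (recordAt c A ω t).control then 1 else 0))

end Execution

/-- The adversary gives rise to a finite instance with `n` packets: almost surely, each of the `n`
packets is injected at some time, and only finitely many slots of the execution are disrupted. -/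
def IsFiniteInstance {n : ℕ} (c : ℝ) (A : Adversary n) : Prop :=
  ∀ᵐ ω ∂(coinMeasure n),
    (∀ u, ∃ t, statusAt c A ω t u ≠ Status.pending) ∧ (disruptedSlots c A ω).Finite

end ReBackoff

end

/-!
The proof follows one potential function along the execution, viewed as a Markov chain (`Snapshot`)
that is driven by independent random numbers; the adversary is part of the state, through the
history.

Let `X` be the contention, the expected number of broadcasts on the data channel. The `potential`
is the sum of three parts. Each packet holds a `Status.bank`: a large weight that it releases by its
success, and a small weight that it releases when it becomes active and regains in proportion to the
fraction of empty data slots of its active period, so that it is complete again when the packet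
becomes inactive. The `coolingTime` is the number of slots until the contention falls below a
constant if nothing else happens. The `maxGap` is the number of empty data slots after which every
active packet would have become inactive. In a slot that is not disrupted, the potential decreases
by a constant in expectation (`integral_potentialChange_le_neg_drift`): for large `X` the cooling
time passes, for moderate `X` a success is likely, for small `X` an empty data slot decreases the
gap, and without active packets some packets become active. In a disrupted slot the expected
increase is at most `1` (`integral_potentialChange_le_one`).

The only event that can increase the cooling time is an empty slot on the control channel, in which
all inactive packets become active. Here the logarithmic factor in the probability of a busy tone is
decisive: if the contention will stay high for `τ` slots, then the control channel is empty with
probability at most of order `τ⁻⁴` (`coolingTime_pow_mul_quietProb_le`). This bounds the expectation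
of the increase, and also the fourth moment of the change of the potential
(`integral_potentialChange_pow_le`).

Four applications of the potential method `lintegral_potential_snapshot_le` give the theorem.
* Stopped when more than `d` slots have been disrupted, the potential shows that the number of slots
  that are not disrupted until then has finite expectation. As the number of disrupted slots is
  almost surely finite, so is the execution (`ae_finite_liveSlots`), and a packet that was injected
  is not live forever.
* For `Z`, the potential plus a multiple of the number of slots plus `n` plus the number of
  disrupted slots, only disrupted slots increase the expectation of the concave function `logSq Z`,
  and since `Z` is at least `n` plus the number `D` of disrupted slots, the increase telescopes to
  `O(log² (n + D + 1))`. So the squared logarithm of the length of the execution has an expectation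
  of this order (`lintegral_logSq_size_le`).
* In a slot in which a packet has age `s`, its success is at least `1 / (2 s)` times as likely as an
  empty data slot, and an empty data slot raises the fraction of empty slots, which has to reach
  `15 / 16` to make the packet inactive, by at most `1 / s`. So the expected number of its active
  periods is bounded, by the potential `Status.retries`. As an active period of `j` slots needs
  `O(log² j)` attempts (`accessSum_le_logSq`), the attempts of a packet are bounded by the squared
  logarithm of the length of the execution (`lintegral_attempts_le`).
* The fourth moments make `1 / margin`, for a suitable distance `margin` of the potential plus a
  multiple of the number of slots minus `2 D` from a high level, a supermartingale. So the execution
  is longer than a constant times `n + D` with probability at most `1 / 2` (`measure_longEvent_le`).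
  As `max n D` slots are not wasted (`ncard_wastedSlots_add_le`), this bounds the expected waste.
-/

noncomputable section

namespace ReBackoff

/-! ### Markov chains driven by independent random numbers -/

section Chain

variable {S E : Type*}

/-- The trajectory of the chain on `S` that starts in `s₀` and moves from `s` to `next s x`, where
`x` is the random number of the present time step. -/
def trajectory (next : S → E → S) (s₀ : S) (ω : ℕ → E) : ℕ → S
  | 0 => s₀
  | t + 1 => next (trajectory next s₀ ω t) (ω t)

theorem trajectory_congr (next : S → E → S) (s₀ : S) {ω ω' : ℕ → E} (t : ℕ)
    (h : ∀ i < t, ω i = ω' i) : trajectory next s₀ ω t = trajectory next s₀ ω' t := by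
  induction t with
  | zero => rfl
  | succ t ih =>
    simp only [trajectory]
    rw [ih fun i hi => h i (by omega), h t (by omega)]

variable [MeasurableSpace S] [DiscreteMeasurableSpace S] [Countable S] [MeasurableSpace E]

theorem measurable_uncurry_of_countable {F : Type*} [MeasurableSpace F] {f : S → E → F}
    (hf : ∀ s, Measurable (f s)) : Measurable (Function.uncurry f) :=
  measurable_from_prod_countable_right hf

theorem measurable_trajectory {next : S → E → S} (hnext : ∀ s, Measurable (next s)) (s₀ : S)
    (t : ℕ) : Measurable fun ω : ℕ → E => trajectory next s₀ ω t := by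
  induction t with
  | zero => exact measurable_const
  | succ t ih =>
    exact (measurable_uncurry_of_countable hnext).comp (ih.prodMk (measurable_pi_apply t))

variable (μ : Measure E) [IsProbabilityMeasure μ]

theorem indepFun_trajectory_eval {next : S → E → S} (hnext : ∀ s, Measurable (next s)) (s₀ : S)
    (t : ℕ) :
    ProbabilityTheory.IndepFun (fun ω : ℕ → E => trajectory next s₀ ω t) (fun ω => ω t)
      (Measure.infinitePi fun _ : ℕ => μ) := by
  classical
  have : Nonempty E := μ.nonempty_of_neZero
  have h := ProbabilityTheory.iIndepFun_infinitePi (P := fun _ : ℕ => μ)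
    (X := fun (_ : ℕ) (x : E) => x) (by fun_prop)
  have h2 := h.indepFun_finset (Finset.range t) {t} (by simp) (fun i => measurable_pi_apply i)
  let ext : (Finset.range t → E) → ℕ → E := fun y i =>
    if hi : i ∈ Finset.range t then y ⟨i, hi⟩ else Classical.arbitrary E
  have hext : Measurable ext := by
    refine measurable_pi_lambda _ fun i => ?_
    by_cases hi : i ∈ Finset.range t
    · simp only [ext, hi, dite_true]
      exact measurable_pi_apply (X := fun _ : Finset.range t => E) ⟨i, hi⟩
    · simp only [ext, hi, dite_false]; exact measurable_const
  have h3 := h2.comp ((measurable_trajectory hnext s₀ t).comp hext)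
    (measurable_pi_apply (X := fun _ : ({t} : Finset ℕ) => E) ⟨t, by simp⟩)
  have hpast : (fun ω : ℕ → E => trajectory next s₀ ω t) =
      ((fun ω => trajectory next s₀ ω t) ∘ ext) ∘ fun ω (i : Finset.range t) => ω i := by
    funext ω
    refine trajectory_congr _ _ _ fun i hi => ?_
    simp [ext, hi]
  rw [hpast]
  exact h3

/-- The random number of a time step is independent of the past. -/
theorem lintegral_trajectory_eval {next : S → E → S} (hnext : ∀ s, Measurable (next s)) (s₀ : S)
    (t : ℕ) {F : S → E → ℝ≥0∞} (hF : ∀ s, Measurable (F s)) :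
    ∫⁻ ω, F (trajectory next s₀ ω t) (ω t) ∂(Measure.infinitePi fun _ : ℕ => μ) =
      ∫⁻ ω, ∫⁻ x, F (trajectory next s₀ ω t) x ∂μ ∂(Measure.infinitePi fun _ : ℕ => μ) := by
  have hm := measurable_trajectory hnext s₀ t
  have hFm := measurable_uncurry_of_countable hF
  have hind := (ProbabilityTheory.indepFun_iff_map_prod_eq_prod_map_map hm.aemeasurable
    (measurable_pi_apply t).aemeasurable).1 (indepFun_trajectory_eval μ hnext s₀ t)
  have hmap : (Measure.infinitePi fun _ : ℕ => μ).map (fun ω => ω t) = μ :=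
    (measurePreserving_eval_infinitePi (fun _ : ℕ => μ) t).map_eq
  have h1 : ∫⁻ ω, F (trajectory next s₀ ω t) (ω t) ∂(Measure.infinitePi fun _ : ℕ => μ) =
      ∫⁻ p, Function.uncurry F p ∂((Measure.infinitePi fun _ : ℕ => μ).map
        fun ω => (trajectory next s₀ ω t, ω t)) := by
    rw [lintegral_map hFm (hm.prodMk (measurable_pi_apply t))]; rfl
  rw [h1, hind, hmap, lintegral_prod _ hFm.aemeasurable, lintegral_map (by fun_prop) hm]
  rfl

/-- If a potential `f` decreases in expectation by `cost` in each step, except for an increase by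
at most `gain`, then the expected total cost is at most the initial potential plus the expected
total gain. -/
theorem lintegral_potential_le {next : S → E → S} (hnext : ∀ s, Measurable (next s)) {s₀ : S}
    (inv : S → Prop) (h₀ : inv s₀) (hinv : ∀ s x, inv s → inv (next s x))
    {f gain : S → ℝ≥0∞} {cost : S → E → ℝ≥0∞} (hcost : ∀ s, Measurable (cost s))
    (h : ∀ s, inv s → ∫⁻ x, (f (next s x) + cost s x) ∂μ ≤ f s + gain s) (T : ℕ) :
    ∫⁻ ω, (f (trajectory next s₀ ω T) +
        ∑ t ∈ Finset.range T, cost (trajectory next s₀ ω t) (ω t))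
        ∂(Measure.infinitePi fun _ : ℕ => μ) ≤
      f s₀ + ∫⁻ ω, ∑ t ∈ Finset.range T, gain (trajectory next s₀ ω t)
        ∂(Measure.infinitePi fun _ : ℕ => μ) := by
  have hm := fun t => measurable_trajectory (E := E) hnext s₀ t
  have hi : ∀ ω t, inv (trajectory next s₀ ω t) := by
    intro ω t
    induction t with
    | zero => exact h₀
    | succ t ih => exact hinv _ _ ih
  have hf : ∀ g : S → ℝ≥0∞, Measurable g := fun g => measurable_of_countable g
  have hfX : ∀ t, Measurable fun ω : ℕ → E => f (trajectory next s₀ ω t) := fun t =>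
    (hf f).comp (hm t)
  have hgX : ∀ t, Measurable fun ω : ℕ → E => gain (trajectory next s₀ ω t) := fun t =>
    (hf gain).comp (hm t)
  have hc : ∀ t, Measurable fun ω : ℕ → E => cost (trajectory next s₀ ω t) (ω t) := fun t =>
    (measurable_uncurry_of_countable hcost).comp ((hm t).prodMk (measurable_pi_apply t))
  induction T with
  | zero => simp [trajectory]
  | succ T ih =>
    simp only [Finset.sum_range_succ]
    rw [lintegral_add_left (hfX _), lintegral_add_right _ (hc T),
      lintegral_add_right _ (hgX T)]
    rw [lintegral_add_left (hfX _)] at ih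
    have hstep : ∫⁻ ω, f (trajectory next s₀ ω (T + 1)) ∂(Measure.infinitePi fun _ : ℕ => μ) +
        ∫⁻ ω, cost (trajectory next s₀ ω T) (ω T) ∂(Measure.infinitePi fun _ : ℕ => μ) ≤
        ∫⁻ ω, f (trajectory next s₀ ω T) ∂(Measure.infinitePi fun _ : ℕ => μ) +
        ∫⁻ ω, gain (trajectory next s₀ ω T) ∂(Measure.infinitePi fun _ : ℕ => μ) := by
      rw [← lintegral_add_left (hfX _), ← lintegral_add_left (hfX _)]
      calc _ = ∫⁻ ω, (fun s x => f (next s x) + cost s x) (trajectory next s₀ ω T) (ω T)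
            ∂(Measure.infinitePi fun _ : ℕ => μ) := rfl
        _ = _ := lintegral_trajectory_eval μ hnext s₀ T
            fun s => ((hf f).comp (hnext s)).add (hcost s)
        _ ≤ _ := lintegral_mono fun ω => h _ (hi ω T)
    calc _ = (∫⁻ ω, f (trajectory next s₀ ω (T + 1)) ∂(Measure.infinitePi fun _ : ℕ => μ) +
          ∫⁻ ω, cost (trajectory next s₀ ω T) (ω T) ∂(Measure.infinitePi fun _ : ℕ => μ)) +
          ∫⁻ ω, ∑ t ∈ Finset.range T, cost (trajectory next s₀ ω t) (ω t)
            ∂(Measure.infinitePi fun _ : ℕ => μ) := by ring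
      _ ≤ _ := add_le_add_left hstep _
      _ = (∫⁻ ω, f (trajectory next s₀ ω T) ∂(Measure.infinitePi fun _ : ℕ => μ) +
          ∫⁻ ω, ∑ t ∈ Finset.range T, cost (trajectory next s₀ ω t) (ω t)
            ∂(Measure.infinitePi fun _ : ℕ => μ)) +
          ∫⁻ ω, gain (trajectory next s₀ ω T) ∂(Measure.infinitePi fun _ : ℕ => μ) := by ring
      _ ≤ _ := by
        rw [← add_assoc]
        exact add_le_add_left ih _

end Chain

/-! ### The random choices of one slot -/

theorem Status.dataProb_nonneg (a : Status) : 0 ≤ a.dataProb := by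
  cases a <;> simp only [Status.dataProb] <;> positivity

theorem Status.dataProb_le_half (a : Status) : a.dataProb ≤ 1 / 2 := by
  cases a with
  | active s e =>
    simp only [Status.dataProb]
    rcases Nat.eq_zero_or_pos s with rfl | hs
    · norm_num
    · exact div_le_self (by norm_num) (by exact_mod_cast hs)
  | _ => simp [Status.dataProb]

theorem Status.controlProb_nonneg {c : ℝ} (hc : 0 < c) (a : Status) : 0 ≤ a.controlProb c := by
  cases a <;> simp only [Status.controlProb, le_refl]
  positivity

theorem Status.controlProb_le_one {c : ℝ} (a : Status) : a.controlProb c ≤ 1 := by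
  cases a <;> simp [Status.controlProb]

theorem volume_unitInterval_lt {p : ℝ} (h0 : 0 ≤ p) (h1 : p ≤ 1) :
    volume {x : I | (x : ℝ) < p} = ENNReal.ofReal p := by
  have := unitInterval.volume_Iio (x := ⟨p, h0, h1⟩)
  convert this using 2
  ext x
  simp [← Subtype.coe_lt_coe]

theorem measurableSet_unitInterval_lt (p : ℝ) : MeasurableSet {x : I | (x : ℝ) < p} :=
  measurableSet_lt measurable_subtype_coe measurable_const

theorem volume_unitInterval_not_lt {p : ℝ} (h0 : 0 ≤ p) (h1 : p ≤ 1) :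
    volume {x : I | ¬ (x : ℝ) < p} = ENNReal.ofReal (1 - p) := by
  have h := prob_compl_eq_one_sub (μ := (volume : Measure I)) (measurableSet_unitInterval_lt p)
  rw [volume_unitInterval_lt h0 h1] at h
  rw [ENNReal.ofReal_sub _ h0, ENNReal.ofReal_one, ← h]
  rfl

section

variable {n : ℕ}

instance : MeasurableSpace (SlotRecord n) := ⊤

instance : DiscreteMeasurableSpace (SlotRecord n) := ⟨fun _ => trivial⟩

instance : Finite (SlotRecord n) :=
  Finite.of_injective (fun r : SlotRecord n => (r.data, r.control)) fun r r' h => by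
    cases r; cases r'; simpa using h

theorem mem_data_iff {c : ℝ} {st : State n} {x : SlotCoins n} {u : Fin n} :
    u ∈ (broadcasts c st x).data ↔ ((x u).1 : ℝ) < (st u).dataProb := by
  simp [broadcasts]

theorem mem_control_iff {c : ℝ} {st : State n} {x : SlotCoins n} {u : Fin n} :
    u ∈ (broadcasts c st x).control ↔ ((x u).2 : ℝ) < (st u).controlProb c := by
  simp [broadcasts]

theorem measurable_broadcasts (c : ℝ) (st : State n) : Measurable (broadcasts c st) := by
  refine measurable_to_countable' fun r => ?_
  have h : broadcasts c st ⁻¹' {r} = ⋂ u : Fin n,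
      ({x : SlotCoins n | ((x u).1 : ℝ) < (st u).dataProb ↔ u ∈ r.data} ∩
        {x : SlotCoins n | ((x u).2 : ℝ) < (st u).controlProb c ↔ u ∈ r.control}) := by
    ext x
    have hr : broadcasts c st x = r ↔
        (broadcasts c st x).data = r.data ∧ (broadcasts c st x).control = r.control := by
      constructor
      · rintro rfl; simp
      · intro h
        generalize broadcasts c st x = y at h
        cases r; cases y; simpa using h
    simp only [Set.mem_preimage, Set.mem_singleton_iff, hr, Finset.ext_iff, mem_data_iff,
      mem_control_iff, Set.mem_iInter, Set.mem_inter_iff, Set.mem_ofPred_eq, forall_and]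
  rw [h]
  refine MeasurableSet.iInter fun u => MeasurableSet.inter ?_ ?_
  · have hm : MeasurableSet {x : SlotCoins n | ((x u).1 : ℝ) < (st u).dataProb} :=
      measurableSet_lt (by fun_prop) measurable_const
    by_cases hu : u ∈ r.data
    · simpa [hu] using hm
    · convert hm.compl using 1
      ext x
      simp [hu]
  · have hm : MeasurableSet {x : SlotCoins n | ((x u).2 : ℝ) < (st u).controlProb c} :=
      measurableSet_lt (by fun_prop) measurable_const
    by_cases hu : u ∈ r.control
    · simpa [hu] using hm
    · convert hm.compl using 1
      ext x
      simp [hu]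

/-- A real function of the record of a slot is integrable, as there are finitely many records. -/
theorem integrable_broadcasts (c : ℝ) (st : State n) (g : SlotRecord n → ℝ) :
    Integrable fun x => g (broadcasts c st x) := by
  obtain ⟨B, hB⟩ := (Set.finite_range fun r => ‖g r‖).bddAbove
  refine Integrable.of_bound
    ((measurable_of_countable g).comp (measurable_broadcasts c st)).aestronglyMeasurable B ?_
  exact Filter.Eventually.of_forall fun x => hB ⟨_, rfl⟩

theorem measurableSet_broadcasts (c : ℝ) (st : State n) (P : SlotRecord n → Prop) :
    MeasurableSet {x | P (broadcasts c st x)} :=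
  measurable_broadcasts c st (MeasurableSet.of_discrete (s := {r | P r}))

theorem integral_broadcasts_ite (c : ℝ) (st : State n) (P : SlotRecord n → Prop)
    [DecidablePred P] :
    ∫ x, (if P (broadcasts c st x) then (1 : ℝ) else 0) =
      (volume : Measure (SlotCoins n)).real {x | P (broadcasts c st x)} := by
  rw [← integral_indicator_one (measurableSet_broadcasts c st P)]
  refine integral_congr_ae (Filter.Eventually.of_forall fun x => ?_)
  simp [Set.indicator_apply]

open Classical in
theorem measureReal_data_eq (c : ℝ) (st : State n) (D : Finset (Fin n)) :
    (volume : Measure (SlotCoins n)).real {x | (broadcasts c st x).data = D} =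
      ∏ u, (if u ∈ D then (st u).dataProb else 1 - (st u).dataProb) := by
  have h : {x | (broadcasts c st x).data = D} = Set.pi Set.univ fun u =>
      {y : I | (y : ℝ) < (st u).dataProb ↔ u ∈ D} ×ˢ (Set.univ : Set I) := by
    ext x
    simp [Finset.ext_iff, mem_data_iff]
  have hv : ∀ u, (volume : Measure (I × I))
      ({y : I | (y : ℝ) < (st u).dataProb ↔ u ∈ D} ×ˢ (Set.univ : Set I)) =
      ENNReal.ofReal (if u ∈ D then (st u).dataProb else 1 - (st u).dataProb) := by
    intro u
    have h0 := (st u).dataProb_nonneg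
    have h1 := (st u).dataProb_le_half
    rw [Measure.volume_eq_prod, Measure.prod_prod, measure_univ, mul_one]
    by_cases hu : u ∈ D
    · simpa [hu] using volume_unitInterval_lt h0 (by linarith)
    · simpa [hu] using volume_unitInterval_not_lt h0 (by linarith)
  have hn : ∀ u, 0 ≤ (if u ∈ D then (st u).dataProb else 1 - (st u).dataProb) := by
    intro u
    have h0 := (st u).dataProb_nonneg
    have h1 := (st u).dataProb_le_half
    split_ifs <;> linarith
  rw [measureReal_def, h, volume_pi_pi]
  simp only [hv]
  rw [← ENNReal.ofReal_prod_of_nonneg fun u _ => hn u,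
    ENNReal.toReal_ofReal (Finset.prod_nonneg fun u _ => hn u)]

theorem measureReal_control_eq_empty {c : ℝ} (hc : 0 < c) (st : State n) :
    (volume : Measure (SlotCoins n)).real {x | (broadcasts c st x).control = ∅} =
      ∏ u, (1 - (st u).controlProb c) := by
  have h : {x | (broadcasts c st x).control = ∅} = Set.pi Set.univ fun u =>
      (Set.univ : Set I) ×ˢ {y : I | ¬ (y : ℝ) < (st u).controlProb c} := by
    ext x
    simp [Finset.ext_iff, mem_control_iff]
  have hv : ∀ u, (volume : Measure (I × I))
      ((Set.univ : Set I) ×ˢ {y : I | ¬ (y : ℝ) < (st u).controlProb c}) =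
      ENNReal.ofReal (1 - (st u).controlProb c) := by
    intro u
    rw [Measure.volume_eq_prod, Measure.prod_prod, measure_univ, one_mul]
    exact volume_unitInterval_not_lt ((st u).controlProb_nonneg hc) (st u).controlProb_le_one
  have hn : ∀ u, 0 ≤ 1 - (st u).controlProb c := fun u =>
    sub_nonneg.2 (st u).controlProb_le_one
  rw [measureReal_def, h, volume_pi_pi]
  simp only [hv]
  rw [← ENNReal.ofReal_prod_of_nonneg fun u _ => hn u,
    ENNReal.toReal_ofReal (Finset.prod_nonneg fun u _ => hn u)]

theorem measurePreserving_eval_slotCoins (u : Fin n) :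
    MeasurePreserving (Function.eval u) (volume : Measure (SlotCoins n)) volume :=
  measurePreserving_eval (fun _ : Fin n => (volume : Measure (I × I))) u

theorem measureReal_mem_data (c : ℝ) (st : State n) (u : Fin n) :
    (volume : Measure (SlotCoins n)).real {x | u ∈ (broadcasts c st x).data} =
      (st u).dataProb := by
  have h : {x | u ∈ (broadcasts c st x).data} =
      Function.eval u ⁻¹' ({y : I | (y : ℝ) < (st u).dataProb} ×ˢ (Set.univ : Set I)) := by
    ext x; simp [mem_data_iff]
  have h1 := (st u).dataProb_le_half
  rw [measureReal_def, h, (measurePreserving_eval_slotCoins u).measure_preimage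
    ((measurableSet_unitInterval_lt _).prod MeasurableSet.univ).nullMeasurableSet,
    Measure.volume_eq_prod, Measure.prod_prod, measure_univ, mul_one,
    volume_unitInterval_lt (st u).dataProb_nonneg (by linarith),
    ENNReal.toReal_ofReal (st u).dataProb_nonneg]

theorem measureReal_mem_control {c : ℝ} (hc : 0 < c) (st : State n) (u : Fin n) :
    (volume : Measure (SlotCoins n)).real {x | u ∈ (broadcasts c st x).control} =
      (st u).controlProb c := by
  have h : {x | u ∈ (broadcasts c st x).control} =
      Function.eval u ⁻¹' ((Set.univ : Set I) ×ˢ {y : I | (y : ℝ) < (st u).controlProb c}) := by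
    ext x; simp [mem_control_iff]
  have h0 := (st u).controlProb_nonneg hc
  rw [measureReal_def, h, (measurePreserving_eval_slotCoins u).measure_preimage
    (MeasurableSet.univ.prod (measurableSet_unitInterval_lt _)).nullMeasurableSet,
    Measure.volume_eq_prod, Measure.prod_prod, measure_univ, one_mul,
    volume_unitInterval_lt h0 (st u).controlProb_le_one, ENNReal.toReal_ofReal h0]

/-- The contention on the data channel: the expected number of broadcasts in the slot. -/
def contention (st : State n) : ℝ := ∑ u, (st u).dataProb

theorem contention_nonneg (st : State n) : 0 ≤ contention st :=
  Finset.sum_nonneg fun u _ => (st u).dataProb_nonneg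

/-- The probability that no packet is broadcast on the data channel. -/
def silenceProb (st : State n) : ℝ := ∏ u, (1 - (st u).dataProb)

theorem measureReal_data_eq_empty (c : ℝ) (st : State n) :
    (volume : Measure (SlotCoins n)).real {x | (broadcasts c st x).data = ∅} =
      silenceProb st := by
  classical
  rw [measureReal_data_eq]
  simp [silenceProb]

theorem silenceProb_nonneg (st : State n) : 0 ≤ silenceProb st :=
  Finset.prod_nonneg fun u _ => by linarith [(st u).dataProb_le_half]

theorem silenceProb_le_exp (st : State n) : silenceProb st ≤ Real.exp (-contention st) := by
  rw [contention, ← Finset.sum_neg_distrib, Real.exp_sum]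
  exact Finset.prod_le_prod (fun u _ => by linarith [(st u).dataProb_le_half])
    fun u _ => by linarith [Real.add_one_le_exp (-(st u).dataProb)]

theorem exp_le_silenceProb (st : State n) : Real.exp (-2 * contention st) ≤ silenceProb st := by
  rw [contention, Finset.mul_sum, Real.exp_sum]
  refine Finset.prod_le_prod (fun u _ => (Real.exp_pos _).le) fun u _ => ?_
  have h0 := (st u).dataProb_nonneg
  have h1 := (st u).dataProb_le_half
  set q := (st u).dataProb
  -- As `exp (2 q) ≥ 1 + 2 q` and `(1 - q) (1 + 2 q) = 1 + q (1 - 2 q) ≥ 1`.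
  rw [neg_mul, Real.exp_neg]
  have h2 : 1 ≤ (1 - q) * Real.exp (2 * q) := by
    have := Real.add_one_le_exp (2 * q)
    nlinarith
  rw [inv_le_iff_one_le_mul₀ (Real.exp_pos _)]
  exact h2

theorem one_sub_contention_le_silenceProb (st : State n) :
    1 - contention st ≤ silenceProb st := by
  have h : ∀ A : Finset (Fin n), 0 ≤ ∏ u ∈ A, (1 - (st u).dataProb) ∧
      ∏ u ∈ A, (1 - (st u).dataProb) ≤ 1 ∧
      1 - ∑ u ∈ A, (st u).dataProb ≤ ∏ u ∈ A, (1 - (st u).dataProb) := by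
    intro A
    induction A using Finset.cons_induction with
    | empty => simp
    | cons u A hu ih =>
      obtain ⟨ih0, ih1, ih2⟩ := ih
      have h0 := (st u).dataProb_nonneg
      have h1 := (st u).dataProb_le_half
      rw [Finset.prod_cons, Finset.sum_cons]
      refine ⟨mul_nonneg (by linarith) ih0, ?_, ?_⟩ <;> nlinarith
  exact (h Finset.univ).2.2

theorem measureReal_data_eq_singleton_ge (c : ℝ) (st : State n) (u : Fin n) :
    (st u).dataProb * silenceProb st ≤
      (volume : Measure (SlotCoins n)).real {x | (broadcasts c st x).data = {u}} := by
  classical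
  rw [measureReal_data_eq, silenceProb, ← Finset.mul_prod_erase _ _ (Finset.mem_univ u),
    ← Finset.mul_prod_erase (s := Finset.univ) (a := u)
      (fun v => if v ∈ ({u} : Finset (Fin n)) then (st v).dataProb else 1 - (st v).dataProb)
      (Finset.mem_univ u)]
  have h : ∏ v ∈ Finset.univ.erase u,
      (if v ∈ ({u} : Finset (Fin n)) then (st v).dataProb else 1 - (st v).dataProb) =
      ∏ v ∈ Finset.univ.erase u, (1 - (st v).dataProb) := by
    refine Finset.prod_congr rfl fun v hv => ?_
    simp [Finset.ne_of_mem_erase hv]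
  have h0 := (st u).dataProb_nonneg
  have hp : 0 ≤ ∏ v ∈ Finset.univ.erase u, (1 - (st v).dataProb) :=
    Finset.prod_nonneg fun v _ => by linarith [(st v).dataProb_le_half]
  rw [h]
  simp only [Finset.mem_singleton, if_true]
  nlinarith [mul_nonneg h0 hp, mul_nonneg h0 (mul_nonneg h0 hp)]

theorem measureReal_exists_data_eq_singleton_ge (c : ℝ) (st : State n) :
    contention st * silenceProb st ≤
      (volume : Measure (SlotCoins n)).real {x | ∃ u, (broadcasts c st x).data = {u}} := by
  have h : {x | ∃ u, (broadcasts c st x).data = {u}} =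
      ⋃ u ∈ (Finset.univ : Finset (Fin n)), {x | (broadcasts c st x).data = {u}} := by
    ext x; simp
  rw [h, measureReal_biUnion_finset, contention, Finset.sum_mul]
  · exact Finset.sum_le_sum fun u _ => measureReal_data_eq_singleton_ge c st u
  · intro u _ v _ huv
    refine Set.disjoint_left.2 fun x (hu : _ = _) (hv : _ = _) => huv ?_
    rw [hu] at hv
    simpa using hv
  · exact fun u _ => measurableSet_broadcasts c st fun r => r.data = {u}

end

/-! ### The potential of a state and its change in one slot -/

/-- The level of contention on the data channel above which slots are regarded as congested. It is
large enough that inactive packets rarely become active in a congested slot. -/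
def congestion (c : ℝ) : ℝ := max 1 (8 / c)

theorem one_le_congestion (c : ℝ) : 1 ≤ congestion c := le_max_left _ _

theorem congestion_pos (c : ℝ) : 0 < congestion c := zero_lt_one.trans_le (one_le_congestion c)

theorem eight_le_mul_congestion {c : ℝ} (hc : 0 < c) : 8 ≤ c * congestion c := by
  have h : 8 / c ≤ congestion c := le_max_right _ _
  rw [div_le_iff₀ hc] at h
  linarith

/-- The part of the potential that a packet releases by its success. With a contention between
`1 / 32` and `congestion c`, a success has probability at least `exp (-2 * congestion c) / 32`, so
that the expected release is at least `1`. -/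
def successWeight (c : ℝ) : ℝ := 32 * Real.exp (2 * congestion c) + 5

theorem successWeight_pos (c : ℝ) : 0 < successWeight c := by
  unfold successWeight; positivity

/-- The part of the potential that a packet releases when it becomes active. -/
def wakeWeight (c : ℝ) : ℝ := 2 / congestion c

theorem wakeWeight_pos (c : ℝ) : 0 < wakeWeight c := div_pos two_pos (congestion_pos c)

theorem wakeWeight_le_two (c : ℝ) : wakeWeight c ≤ 2 :=
  div_le_self two_pos.le (one_le_congestion c)

/-- The potential of a single packet. While the packet is active, `wakeWeight` is restored
in proportion to the fraction of empty data slots, so that nothing is left to pay when the packet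
becomes inactive again. -/
def Status.bank (c : ℝ) : Status → ℝ
  | .pending => successWeight c + wakeWeight c
  | .inactive => successWeight c + wakeWeight c
  | .active s e => successWeight c + wakeWeight c * (16 / 15) * ((e : ℝ) / ((s : ℝ) - 1))
  | .done => 0

/-- The contribution of a packet to the contention on the data channel after `τ` further slots, if
it stays active until then. -/
def Status.laterProb (τ : ℕ) : Status → ℝ
  | .active s _ => (1 / 2) / ((s : ℝ) + τ)
  | _ => 0

/-- The number of further empty data slots that would make an active packet inactive; it is `0` only
in the first slot of an active period. -/
def Status.gap : Status → ℕ
  | .active s e => 15 * (s - 1) - 16 * e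
  | _ => 0

/-- The restrictions that the protocol imposes on the age and on the number of empty data slots of
an active packet. -/
def Status.Valid : Status → Prop
  | .active s e => 1 ≤ s ∧ (s = 1 ∧ e = 0 ∨ 16 * e < 15 * (s - 1))
  | _ => True

theorem Status.laterProb_nonneg (τ : ℕ) (a : Status) : 0 ≤ a.laterProb τ := by
  cases a <;> simp only [Status.laterProb, le_refl]
  positivity

theorem Status.laterProb_zero (a : Status) : a.laterProb 0 = a.dataProb := by
  cases a <;> simp [Status.laterProb, Status.dataProb]

theorem Status.laterProb_antitone {a : Status} (ha : a.Valid) {τ τ' : ℕ} (h : τ ≤ τ') :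
    a.laterProb τ' ≤ a.laterProb τ := by
  cases a <;> simp only [Status.laterProb, le_refl]
  rename_i s e
  have hs : (1 : ℝ) ≤ s := by exact_mod_cast ha.1
  have : (τ : ℝ) ≤ τ' := by exact_mod_cast h
  gcongr

theorem Status.Valid.fraction_nonneg {s e : ℕ} (h : (Status.active s e).Valid) :
    0 ≤ (e : ℝ) / ((s : ℝ) - 1) := by
  have hs : (1 : ℝ) ≤ s := by exact_mod_cast h.1
  exact div_nonneg (Nat.cast_nonneg _) (by linarith)

theorem Status.bank_nonneg {c : ℝ} {a : Status} (ha : a.Valid) : 0 ≤ a.bank c := by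
  have h1 := successWeight_pos c
  have h2 := wakeWeight_pos c
  cases a with
  | active s e =>
    have := ha.fraction_nonneg
    simp only [Status.bank]
    positivity
  | _ => simp only [Status.bank]; positivity

section

variable {n : ℕ}

/-- The contention on the data channel after `τ` further slots if no status changes otherwise. -/
def laterContention (st : State n) (τ : ℕ) : ℝ := ∑ u, (st u).laterProb τ

theorem laterContention_zero (st : State n) : laterContention st 0 = contention st := by
  simp [laterContention, contention, Status.laterProb_zero]

theorem laterContention_antitone {st : State n} (h : ∀ u, (st u).Valid) {τ τ' : ℕ} (hτ : τ ≤ τ') :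
    laterContention st τ' ≤ laterContention st τ :=
  Finset.sum_le_sum fun u _ => (st u).laterProb_antitone (h u) hτ

theorem exists_laterContention_le {st : State n} (h : ∀ u, (st u).Valid) {M : ℝ} (hM : 0 < M) :
    ∃ τ, laterContention st τ ≤ M := by
  obtain ⟨τ, hτ⟩ := exists_nat_ge (n / M)
  refine ⟨τ, ?_⟩
  rw [div_le_iff₀ hM] at hτ
  have h1 : ∀ u ∈ Finset.univ, (st u).laterProb τ ≤ 1 / ((1 : ℝ) + τ) := by
    intro u _
    have hu := h u
    generalize st u = a at hu
    cases a with
    | active s e =>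
      have hs : (1 : ℝ) ≤ s := by exact_mod_cast hu.1
      simp only [Status.laterProb]
      gcongr
      norm_num
    | _ => simp only [Status.laterProb]; positivity
  refine (Finset.sum_le_sum h1).trans ?_
  rw [Finset.sum_const, Finset.card_univ, Fintype.card_fin, nsmul_eq_mul, mul_one_div,
    div_le_iff₀ (by positivity)]
  nlinarith

/-- The number of slots until the contention on the data channel is at most `M` if no status
changes otherwise. -/
def coolingTime (M : ℝ) (st : State n) : ℕ := sInf {τ | laterContention st τ ≤ M}

theorem laterContention_coolingTime_le {st : State n} (h : ∀ u, (st u).Valid) {M : ℝ}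
    (hM : 0 < M) : laterContention st (coolingTime M st) ≤ M :=
  Nat.sInf_mem (exists_laterContention_le h hM)

theorem coolingTime_le {st : State n} {M : ℝ} {τ : ℕ} (h : laterContention st τ ≤ M) :
    coolingTime M st ≤ τ :=
  Nat.sInf_le h

theorem lt_laterContention {st : State n} {M : ℝ} {τ : ℕ} (h : τ < coolingTime M st) :
    M < laterContention st τ :=
  not_le.1 fun h' => absurd (coolingTime_le h') (not_le.2 h)

theorem contention_le_of_coolingTime_eq_zero {st : State n} (h : ∀ u, (st u).Valid) {M : ℝ}
    (hM : 0 < M) (h0 : coolingTime M st = 0) : contention st ≤ M := by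
  have := laterContention_coolingTime_le h hM
  rwa [h0, laterContention_zero] at this

theorem coolingTime_eq_zero {st : State n} {M : ℝ} (h : contention st ≤ M) :
    coolingTime M st = 0 :=
  Nat.le_zero.1 (coolingTime_le (by rwa [laterContention_zero]))

/-- The largest number of further empty data slots that would make an active packet inactive. All
the numbers `Status.gap` change by the same amounts, so this is the gap of the oldest packet. -/
def maxGap (st : State n) : ℕ := Finset.univ.sup fun u => (st u).gap

theorem gap_le_maxGap (st : State n) (u : Fin n) : (st u).gap ≤ maxGap st :=
  Finset.le_sup (f := fun u => (st u).gap) (Finset.mem_univ u)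

open Classical in
/-- The number of inactive packets. -/
def numInactive (st : State n) : ℕ := (Finset.univ.filter fun u => st u = .inactive).card

/-- The potential of a state: the banks of the packets, the time until the contention is moderate,
and a small multiple of the largest gap. The factor `1 / 32` balances that a data slot that is not
empty increases the gaps by `15`. -/
def potential (c : ℝ) (st : State n) : ℝ :=
  ∑ u, (st u).bank c + coolingTime (congestion c) st + (1 / 32) * maxGap st

theorem potential_nonneg {c : ℝ} {st : State n} (h : ∀ u, (st u).Valid) :
    0 ≤ potential c st := by
  have := Finset.sum_nonneg fun u (_ : u ∈ Finset.univ) => Status.bank_nonneg (c := c) (h u)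
  unfold potential
  positivity

theorem valid_arrive {st : State n} (h : ∀ u, (st u).Valid) (dec : Decision n) (u : Fin n) :
    (arrive st dec u).Valid := by
  have hu := h u
  unfold arrive
  generalize st u = a at hu
  cases a with
  | pending => dsimp only; split_ifs <;> trivial
  | active s e => exact hu
  | _ => trivial

theorem step_pending {dec : Decision n} {st : State n} {r : SlotRecord n} {u : Fin n}
    (h : st u = .pending) : step dec st r u = .pending := by
  simp [step, h]

open Classical in
theorem step_inactive {dec : Decision n} {st : State n} {r : SlotRecord n} {u : Fin n}
    (h : st u = .inactive) :
    step dec st r u = if ControlEmpty dec r then .active 1 0 else .inactive := by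
  simp only [step, h]

theorem step_done {dec : Decision n} {st : State n} {r : SlotRecord n} {u : Fin n}
    (h : st u = .done) : step dec st r u = .done := by
  simp [step, h]

open Classical in
theorem step_active {dec : Decision n} {st : State n} {r : SlotRecord n} {u : Fin n} {s e : ℕ}
    (h : st u = .active s e) :
    step dec st r u = if Succeeds dec r u then .done else
      if (15 / 16 : ℝ) * s ≤ ((if DataEmpty dec r then e + 1 else e : ℕ) : ℝ) then .inactive
      else .active (s + 1) (if DataEmpty dec r then e + 1 else e) := by
  simp only [step, h]

theorem valid_step (dec : Decision n) (st : State n) (r : SlotRecord n) (u : Fin n) :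
    (step dec st r u).Valid := by
  classical
  rcases hu : st u with _ | _ | ⟨s, e⟩ | _
  · rw [step_pending hu]; trivial
  · rw [step_inactive hu]; split_ifs <;> simp [Status.Valid]
  · rw [step_active hu]
    split_ifs with h1 h2 h3 h4
    · trivial
    · trivial
    · refine ⟨by omega, Or.inr ?_⟩
      rw [not_le] at h3
      have : (16 * (e + 1) : ℝ) < 15 * s := by push_cast at h3; linarith
      simpa using (by exact_mod_cast this : 16 * (e + 1) < 15 * s)
    · trivial
    · refine ⟨by omega, Or.inr ?_⟩
      rw [not_le] at h4
      have : (16 * e : ℝ) < 15 * s := by linarith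
      simpa using (by exact_mod_cast this : 16 * e < 15 * s)
  · rw [step_done hu]; trivial

theorem bank_arrive (c : ℝ) (st : State n) (dec : Decision n) (u : Fin n) :
    (arrive st dec u).bank c = (st u).bank c := by
  unfold arrive
  cases st u with
  | pending => dsimp only; split_ifs <;> rfl
  | _ => rfl

theorem potential_arrive (c : ℝ) (st : State n) (dec : Decision n) :
    potential c (arrive st dec) = potential c st := by
  have h1 : ∀ τ u, (arrive st dec u).laterProb τ = (st u).laterProb τ := by
    intro τ u
    unfold arrive
    cases st u with
    | pending => dsimp only; split_ifs <;> rfl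
    | _ => rfl
  have h2 : ∀ u, (arrive st dec u).gap = (st u).gap := by
    intro u
    unfold arrive
    cases st u with
    | pending => dsimp only; split_ifs <;> rfl
    | _ => rfl
  simp only [potential, coolingTime, laterContention, maxGap, bank_arrive, h1, h2]

/-- A packet that is broadcast on the data channel is active. -/
theorem exists_eq_active_of_mem_data {c : ℝ} {st : State n} {x : SlotCoins n} {u : Fin n}
    (h : u ∈ (broadcasts c st x).data) : ∃ s e, st u = .active s e := by
  rw [mem_data_iff] at h
  have h0 := unitInterval.nonneg (x u).1
  rcases hu : st u with _ | _ | ⟨s, e⟩ | _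
  · rw [hu] at h; exact absurd h (not_lt.2 h0)
  · rw [hu] at h; exact absurd h (not_lt.2 h0)
  · exact ⟨s, e, rfl⟩
  · rw [hu] at h; exact absurd h (not_lt.2 h0)

open Classical in
theorem bank_step_le {c : ℝ} (dec : Decision n) {st : State n} (h : ∀ u, (st u).Valid)
    (x : SlotCoins n) (u : Fin n) :
    (step dec st (broadcasts c st x) u).bank c ≤ (st u).bank c
      - successWeight c * (if Succeeds dec (broadcasts c st x) u then 1 else 0)
      + 32 / 15 * wakeWeight c * (st u).dataProb *
        (if DataEmpty dec (broadcasts c st x) then 1 else 0)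
      - wakeWeight c * (if st u = .inactive then 1 else 0) *
        (if ControlEmpty dec (broadcasts c st x) then 1 else 0) := by
  set r := broadcasts c st x with hr
  have hw := wakeWeight_pos c
  have hα := successWeight_pos c
  have hsucc : Succeeds dec r u → ∃ s e, st u = .active s e := fun hs =>
    exists_eq_active_of_mem_data (c := c) (x := x) (by rw [← hr, hs.2]; simp)
  rcases hu : st u with _ | _ | ⟨s, e⟩ | _
  · have : ¬ Succeeds dec r u := fun hs => by simpa [hu] using hsucc hs
    rw [step_pending hu]
    simp [this, Status.dataProb]
  · have : ¬ Succeeds dec r u := fun hs => by simpa [hu] using hsucc hs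
    rw [step_inactive hu]
    by_cases hce : ControlEmpty dec r <;> simp [this, Status.dataProb, Status.bank, hce]
  · have hv := h u
    rw [hu] at hv
    have hs1 : (1 : ℝ) ≤ s := by exact_mod_cast hv.1
    have hfrac := hv.fraction_nonneg
    have hbe : 0 ≤ wakeWeight c * (16 / 15) * ((e : ℝ) / ((s : ℝ) - 1)) := by positivity
    rw [step_active hu]
    by_cases hsu : Succeeds dec r u
    · have : ¬ DataEmpty dec r := fun hd => by
        have := hsu.2.symm.trans hd.2
        simp at this
      simp only [hsu, this, if_true, if_false, Status.bank, reduceCtorEq]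
      linarith
    · simp only [hsu, if_false, reduceCtorEq, mul_zero, zero_mul, sub_zero]
      -- The fraction of empty slots increases by at most `1 / s`.
      have hfr : ((if DataEmpty dec r then e + 1 else e : ℕ) : ℝ) / s ≤
          (e : ℝ) / ((s : ℝ) - 1) + 1 / s * (if DataEmpty dec r then 1 else 0) := by
        have h1 : (e : ℝ) / s ≤ (e : ℝ) / ((s : ℝ) - 1) := by
          rcases hv.2 with ⟨_, rfl⟩ | h2
          · simp
          · have : 1 < s := by omega
            have : (1 : ℝ) < s := by exact_mod_cast this
            exact div_le_div_of_nonneg_left (Nat.cast_nonneg _) (by linarith) (by linarith)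
        split_ifs
        · push_cast
          rw [add_div]
          linarith
        · simpa using h1
      have hsp : 32 / 15 * wakeWeight c * (Status.active s e).dataProb =
          wakeWeight c * (16 / 15) * (1 / s) := by
        simp only [Status.dataProb]; field_simp; norm_num
      rw [hsp]
      have hmul := mul_le_mul_of_nonneg_left hfr (by positivity : 0 ≤ wakeWeight c * (16 / 15))
      split_ifs at hmul ⊢ with hd hq hq
      · simp only [Status.bank]
        have : 15 / 16 ≤ ((e + 1 : ℕ) : ℝ) / s := by
          rw [le_div_iff₀ (by linarith)]; exact hq
        nlinarith
      · simp only [Status.bank]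
        have : ((s + 1 : ℕ) : ℝ) - 1 = s := by push_cast; ring
        rw [this]
        linarith
      · simp only [Status.bank]
        have : 15 / 16 ≤ ((e : ℕ) : ℝ) / s := by
          rw [le_div_iff₀ (by linarith)]; exact hq
        nlinarith
      · simp only [Status.bank]
        have : ((s + 1 : ℕ) : ℝ) - 1 = s := by push_cast; ring
        rw [this]
        linarith
  · have : ¬ Succeeds dec r u := fun hs => by simpa [hu] using hsucc hs
    rw [step_done hu]
    simp [this, Status.dataProb]

open Classical in
theorem laterProb_step_le {dec : Decision n} {st : State n} (r : SlotRecord n) (u : Fin n)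
    (τ : ℕ) :
    (step dec st r u).laterProb τ ≤ (st u).laterProb (τ + 1) +
      (if st u = .inactive then 1 else 0) *
        ((if ControlEmpty dec r then 1 else 0) * ((1 / 2) / (1 + (τ : ℝ)))) := by
  rcases hu : st u with _ | _ | ⟨s, e⟩ | _
  · rw [step_pending hu]; simp [Status.laterProb]
  · rw [step_inactive hu]
    by_cases hce : ControlEmpty dec r <;> simp [Status.laterProb, hce]
  · rw [step_active hu]
    have h1 := (Status.active s e).laterProb_nonneg (τ + 1)
    have h2 : ∀ e', (Status.active (s + 1) e').laterProb τ =
        (Status.active s e).laterProb (τ + 1) := by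
      intro e'
      simp only [Status.laterProb]
      push_cast
      ring
    simp only [reduceCtorEq, if_false, zero_mul, add_zero]
    split_ifs
    · exact h1
    · exact h1
    · exact (h2 _).le
    · exact h1
    · exact (h2 _).le
  · rw [step_done hu]; simp [Status.laterProb]

open Classical in
theorem laterContention_step_le {dec : Decision n} {st : State n} (r : SlotRecord n) (τ : ℕ) :
    laterContention (step dec st r) τ ≤ laterContention st (τ + 1) +
      (if ControlEmpty dec r then 1 else 0) * (numInactive st * ((1 / 2) / (1 + (τ : ℝ)))) := by
  refine (Finset.sum_le_sum fun u _ => laterProb_step_le r u τ).trans ?_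
  rw [Finset.sum_add_distrib, ← Finset.sum_mul, Finset.sum_boole]
  refine le_of_eq ?_
  simp only [laterContention, numInactive]
  ring

open Classical in
theorem coolingTime_step_le {dec : Decision n} {st : State n} (h : ∀ u, (st u).Valid)
    (r : SlotRecord n) {M : ℝ} (hM : 0 < M) :
    (coolingTime M (step dec st r) : ℝ) ≤ coolingTime M st
      - (if 1 ≤ coolingTime M st then 1 else 0)
      + (if ControlEmpty dec r then 1 else 0) *
        (coolingTime (M / 2) st + numInactive st / M) := by
  have hpos : (0 : ℝ) ≤ coolingTime M st - (if 1 ≤ coolingTime M st then 1 else 0) := by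
    split_ifs with h1
    · have : (1 : ℝ) ≤ coolingTime M st := by exact_mod_cast h1
      linarith
    · simp
  by_cases hce : ControlEmpty dec r
  · -- After this many slots the old packets and the new ones contribute at most `M / 2` each.
    set τ := coolingTime (M / 2) st + ⌊(numInactive st : ℝ) / M⌋₊ with hτ
    have hk : (numInactive st : ℝ) / M < 1 + τ := by
      have := Nat.lt_floor_add_one ((numInactive st : ℝ) / M)
      rw [hτ]; push_cast
      have : (0 : ℝ) ≤ coolingTime (M / 2) st := Nat.cast_nonneg _
      linarith
    have hle : coolingTime M (step dec st r) ≤ τ := by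
      refine coolingTime_le ((laterContention_step_le r τ).trans ?_)
      have h1 : laterContention st (τ + 1) ≤ M / 2 :=
        (laterContention_antitone h (by omega)).trans
          (laterContention_coolingTime_le h (half_pos hM))
      have h2 : (numInactive st : ℝ) * ((1 / 2) / (1 + (τ : ℝ))) ≤ M / 2 := by
        rw [div_lt_iff₀ hM] at hk
        rw [mul_div_assoc', div_le_iff₀ (by positivity)]
        linarith
      simp only [hce, if_true]
      linarith
    have hfl : (⌊(numInactive st : ℝ) / M⌋₊ : ℝ) ≤ numInactive st / M :=
      Nat.floor_le (by positivity)
    have : (coolingTime M (step dec st r) : ℝ) ≤ τ := by exact_mod_cast hle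
    rw [hτ] at this
    push_cast at this
    simp only [hce, if_true] at hpos ⊢
    linarith
  · have hle : coolingTime M (step dec st r) ≤ coolingTime M st - 1 := by
      refine coolingTime_le ((laterContention_step_le r _).trans ?_)
      simp only [hce, if_false, zero_mul, add_zero]
      exact (laterContention_antitone h (by omega)).trans (laterContention_coolingTime_le h hM)
    simp only [hce, if_false, zero_mul, add_zero]
    have : (coolingTime M (step dec st r) : ℝ) ≤ ((coolingTime M st - 1 : ℕ) : ℝ) := by
      exact_mod_cast hle
    refine this.trans ?_
    split_ifs with h1
    · rw [Nat.cast_sub h1]; simp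
    · simp

theorem gap_step_le {dec : Decision n} {st : State n} (h : ∀ u, (st u).Valid)
    (r : SlotRecord n) (u : Fin n) :
    (step dec st r u).gap ≤ (st u).gap + 15 ∧
      (DataEmpty dec r → (step dec st r u).gap ≤ (st u).gap - 1) := by
  classical
  rcases hu : st u with _ | _ | ⟨s, e⟩ | _
  · rw [step_pending hu]; simp [Status.gap]
  · rw [step_inactive hu]
    split_ifs <;> simp [Status.gap]
  · have hv := h u
    rw [hu] at hv
    have := hv.1
    rw [step_active hu]
    split_ifs <;> simp_all [Status.gap] <;> omega
  · rw [step_done hu]; simp [Status.gap]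

open Classical in
theorem maxGap_step_le {dec : Decision n} {st : State n} (h : ∀ u, (st u).Valid)
    (r : SlotRecord n) :
    (maxGap (step dec st r) : ℝ) ≤ maxGap st + (15 * (if DataEmpty dec r then 0 else 1)
      - (if DataEmpty dec r ∧ 1 ≤ maxGap st then 1 else 0)) := by
  by_cases hd : DataEmpty dec r
  · have h1 : maxGap (step dec st r) ≤ maxGap st - 1 :=
      Finset.sup_le fun u _ => ((gap_step_le h r u).2 hd).trans
        (Nat.sub_le_sub_right (gap_le_maxGap st u) 1)
    have h2 : (maxGap (step dec st r) : ℝ) ≤ ((maxGap st - 1 : ℕ) : ℝ) := by exact_mod_cast h1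
    by_cases hg : 1 ≤ maxGap st
    · rw [Nat.cast_sub hg] at h2
      simp only [hd, hg, and_self, if_true]
      push_cast at h2
      linarith
    · simp only [hd, hg, and_false, if_true, if_false]
      have : maxGap st = 0 := by omega
      simp only [this, Nat.zero_sub] at h2 ⊢
      linarith
  · have h1 : maxGap (step dec st r) ≤ maxGap st + 15 :=
      Finset.sup_le fun u _ => (gap_step_le h r u).1.trans
        (Nat.add_le_add_right (gap_le_maxGap st u) 15)
    have h2 : (maxGap (step dec st r) : ℝ) ≤ ((maxGap st + 15 : ℕ) : ℝ) := by exact_mod_cast h1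
    simp only [hd, false_and, if_false]
    push_cast at h2
    linarith

open Classical in
/-- An upper bound for the change of the potential in a slot. -/
def potentialChange (c : ℝ) (dec : Decision n) (st : State n) (r : SlotRecord n) : ℝ :=
  -successWeight c * (if ∃ u, Succeeds dec r u then 1 else 0)
    + 32 / 15 * wakeWeight c * contention st * (if DataEmpty dec r then 1 else 0)
    - (if 1 ≤ coolingTime (congestion c) st then 1 else 0)
    + (coolingTime (congestion c / 2) st - (if 1 ≤ numInactive st then 1 else 0) / congestion c) *
      (if ControlEmpty dec r then 1 else 0)
    + (1 / 32) * (15 * (if DataEmpty dec r then 0 else 1)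
      - (if DataEmpty dec r ∧ 1 ≤ maxGap st then 1 else 0))

theorem potential_step_le {c : ℝ} (dec : Decision n) {st : State n}
    (h : ∀ u, (st u).Valid) (x : SlotCoins n) :
    potential c (step dec st (broadcasts c st x)) ≤
      potential c st + potentialChange c dec st (broadcasts c st x) := by
  classical
  set r := broadcasts c st x with hr
  have h1 := Finset.sum_le_sum fun u (_ : u ∈ Finset.univ) => bank_step_le (c := c) dec h x u
  rw [← hr] at h1
  simp only [Finset.sum_add_distrib, Finset.sum_sub_distrib, ← Finset.mul_sum,
    ← Finset.sum_mul] at h1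
  have h2 := coolingTime_step_le (dec := dec) h r (congestion_pos c)
  have h3 := maxGap_step_le (dec := dec) h r
  have hs : (if ∃ u, Succeeds dec r u then (1 : ℝ) else 0) ≤
      ∑ u, (if Succeeds dec r u then 1 else 0) := by
    split_ifs with hex
    · obtain ⟨u, hu⟩ := hex
      have := Finset.single_le_sum (f := fun u => if Succeeds dec r u then (1 : ℝ) else 0)
        (fun v _ => by split_ifs <;> norm_num) (Finset.mem_univ u)
      simpa [hu] using this
    · exact Finset.sum_nonneg fun v _ => by split_ifs <;> norm_num
  have hs' := mul_le_mul_of_nonneg_left hs (successWeight_pos c).le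
  have hk : ∑ u, (if st u = .inactive then (1 : ℝ) else 0) = numInactive st := by
    simp [numInactive]
  rw [hk] at h1
  have hk1 : (if 1 ≤ numInactive st then (1 : ℝ) else 0) / congestion c ≤
      numInactive st / congestion c := by
    have := congestion_pos c
    gcongr
    split_ifs with h0
    · exact_mod_cast h0
    · positivity
  have hk2 : wakeWeight c * (numInactive st : ℝ) =
      numInactive st / congestion c + numInactive st / congestion c := by
    unfold wakeWeight; ring
  rw [hk2] at h1
  have hcont : ∑ u, (st u).dataProb = contention st := rfl
  rw [hcont] at h1
  have h3' := mul_le_mul_of_nonneg_left h3 (by norm_num : (0 : ℝ) ≤ 1 / 32)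
  unfold potential potentialChange
  by_cases hce : ControlEmpty dec r
  · simp only [hce, if_true, mul_one, one_mul] at h1 h2 ⊢
    linarith
  · simp only [hce, if_false, mul_zero, zero_mul] at h1 h2 ⊢
    linarith

end

/-! ### The expected change of the potential in one slot -/

/-- The function `max (log x) 1 / x`, which governs the busy tones, is decreasing. -/
theorem max_log_one_mul_le {x y : ℝ} (hx : 0 < x) (hxy : x ≤ y) :
    max (Real.log y) 1 * x ≤ max (Real.log x) 1 * y := by
  have hy : 0 < y := hx.trans_le hxy
  rcases le_total (Real.log y) 1 with hy1 | hy1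
  · rw [max_eq_right hy1, one_mul]
    nlinarith [le_max_right (Real.log x) 1]
  · rw [max_eq_left hy1]
    have hlog : ∀ z, 0 < z → Real.log y ≤ Real.log z + (y / z - 1) := by
      intro z hz
      have := Real.log_le_sub_one_of_pos (div_pos hy hz)
      rw [Real.log_div hy.ne' hz.ne'] at this
      linarith
    rcases le_total 1 (Real.log x) with hx1 | hx1
    · rw [max_eq_left hx1]
      have h := mul_le_mul_of_nonneg_right (hlog x hx) hx.le
      have h' : (Real.log x + (y / x - 1)) * x = Real.log x * x + y - x := by
        field_simp
        ring
      nlinarith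
    · rw [max_eq_right hx1, one_mul]
      have h := hlog (Real.exp 1) (Real.exp_pos _)
      rw [Real.log_exp] at h
      have hxe : x ≤ Real.exp 1 := by
        rwa [← Real.log_le_iff_le_exp hx]
      have h2 : Real.log y * x ≤ (y / Real.exp 1) * Real.exp 1 :=
        mul_le_mul (by linarith) hxe hx.le (by positivity)
      rwa [div_mul_cancel₀ _ (Real.exp_pos 1).ne'] at h2

theorem one_sub_controlProb_le {c : ℝ} (hc : 0 < c) {a : Status} (ha : a.Valid) (τ : ℕ) :
    1 - a.controlProb c ≤ Real.exp (-(2 * c * max (Real.log (1 + τ)) 1 * a.laterProb τ)) := by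
  cases a with
  | active s e =>
    have hs : (1 : ℝ) ≤ s := by exact_mod_cast ha.1
    have hsτ : (0 : ℝ) < s + τ := by positivity
    have h1 : max (Real.log (1 + τ)) 1 ≤ max (Real.log (s + τ)) 1 :=
      max_le_max_right _ (Real.log_le_log (by positivity) (by linarith))
    have h2 := max_log_one_mul_le (x := s) (y := s + τ) (by linarith) (by simp)
    have h3 : 2 * c * max (Real.log (1 + τ)) 1 * ((1 / 2) / ((s : ℝ) + τ)) ≤
        c * max (Real.log s) 1 / s := by
      rw [mul_div_assoc', div_le_div_iff₀ hsτ (by linarith)]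
      have h4 := mul_le_mul_of_nonneg_right h1 (by linarith : (0 : ℝ) ≤ s)
      nlinarith [mul_le_mul_of_nonneg_left (h4.trans h2) hc.le]
    simp only [Status.controlProb, Status.laterProb]
    rcases le_total 1 (c * max (Real.log s) 1 / s) with h | h
    · rw [min_eq_left h, sub_self]; positivity
    · rw [min_eq_right h]
      have := Real.add_one_le_exp (-(2 * c * max (Real.log (1 + τ)) 1 * ((1 / 2) / ((s : ℝ) + τ))))
      linarith
  | _ => simp [Status.controlProb, Status.laterProb]

theorem integral_linear_combination {Ω : Type*} [MeasurableSpace Ω] {μ : Measure Ω}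
    [IsProbabilityMeasure μ] {f₁ f₂ f₃ : Ω → ℝ} (h₁ : Integrable f₁ μ) (h₂ : Integrable f₂ μ)
    (h₃ : Integrable f₃ μ) (a₁ a₂ a₃ k : ℝ) :
    ∫ x, (a₁ * f₁ x + a₂ * f₂ x + a₃ * f₃ x + k) ∂μ =
      a₁ * ∫ x, f₁ x ∂μ + a₂ * ∫ x, f₂ x ∂μ + a₃ * ∫ x, f₃ x ∂μ + k := by
  have i₁ := h₁.const_mul a₁
  have i₂ := h₂.const_mul a₂
  have i₃ := h₃.const_mul a₃
  have i₁₂ : Integrable (fun x => a₁ * f₁ x + a₂ * f₂ x) μ := i₁.add i₂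
  have i₁₂₃ : Integrable (fun x => a₁ * f₁ x + a₂ * f₂ x + a₃ * f₃ x) μ := i₁₂.add i₃
  rw [integral_add i₁₂₃ (integrable_const _), integral_add i₁₂ i₃, integral_add i₁ i₂,
    integral_const_mul, integral_const_mul, integral_const_mul, integral_const]
  simp

section

variable {n : ℕ}

/-- The probability that no busy tone is sent. -/
def quietProb (c : ℝ) (st : State n) : ℝ := ∏ u, (1 - (st u).controlProb c)

theorem quietProb_nonneg (c : ℝ) (st : State n) : 0 ≤ quietProb c st :=
  Finset.prod_nonneg fun u _ => sub_nonneg.2 (st u).controlProb_le_one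

theorem quietProb_le_exp {c : ℝ} (hc : 0 < c) {st : State n} (h : ∀ u, (st u).Valid) (τ : ℕ) :
    quietProb c st ≤
      Real.exp (-(2 * c * max (Real.log (1 + τ)) 1 * laterContention st τ)) := by
  rw [laterContention, Finset.mul_sum, ← Finset.sum_neg_distrib, Real.exp_sum]
  exact Finset.prod_le_prod (fun u _ => sub_nonneg.2 (st u).controlProb_le_one)
    fun u _ => one_sub_controlProb_le hc (h u) τ

/-- While the contention stays high for a long time, inactive packets are very unlikely to become
active: the contribution of a packet of age `s` to the busy tones exceeds its contribution to the
data channel by a factor of order `log s`, and packets that keep the contention high for `τ` slots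
are mostly of age at least `τ`. -/
theorem coolingTime_pow_mul_quietProb_le {c : ℝ} (hc : 0 < c) {st : State n}
    (h : ∀ u, (st u).Valid) :
    (coolingTime (congestion c / 2) st : ℝ) ^ 4 * quietProb c st ≤ 1 / 4 := by
  rcases Nat.eq_zero_or_pos (coolingTime (congestion c / 2) st) with h0 | h0
  · rw [h0]; norm_num
  · obtain ⟨τ, hτ⟩ : ∃ τ, coolingTime (congestion c / 2) st = τ + 1 :=
      ⟨_, (Nat.succ_pred_eq_of_pos h0).symm⟩
    have hl : congestion c / 2 < laterContention st τ := lt_laterContention (by omega)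
    have hK := eight_le_mul_congestion hc
    set m := max (Real.log (1 + τ)) 1 with hm
    have hm1 : 1 ≤ m := le_max_right _ _
    have hlog : Real.log (1 + τ) ≤ m := le_max_left _ _
    have hY : 4 * Real.log (1 + τ) + 4 ≤ 2 * c * m * laterContention st τ := by
      have h1 : 8 ≤ 2 * c * laterContention st τ := by nlinarith
      nlinarith
    have hq : quietProb c st ≤ Real.exp (-(4 * Real.log (1 + τ) + 4)) :=
      (quietProb_le_exp hc h τ).trans (Real.exp_le_exp.2 (by linarith))
    have hpos : (0 : ℝ) < 1 + τ := by positivity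
    have he : Real.exp (-(4 * Real.log (1 + τ) + 4)) * (1 + (τ : ℝ)) ^ 4 = Real.exp (-4) := by
      have : (1 + (τ : ℝ)) ^ 4 = Real.exp (4 * Real.log (1 + τ)) := by
        rw [mul_comm, Real.exp_mul, Real.exp_log hpos]
        norm_cast
      rw [this, ← Real.exp_add]
      ring_nf
    have he4 : Real.exp (-4) ≤ 1 / 4 := by
      rw [Real.exp_neg, ← one_div]
      exact one_div_le_one_div_of_le (by norm_num) (by linarith [Real.add_one_le_exp (4 : ℝ)])
    have hcast : (coolingTime (congestion c / 2) st : ℝ) = 1 + τ := by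
      rw [hτ]; push_cast; ring
    rw [hcast]
    calc (1 + (τ : ℝ)) ^ 4 * quietProb c st
        ≤ (1 + (τ : ℝ)) ^ 4 * Real.exp (-(4 * Real.log (1 + τ) + 4)) := by gcongr
      _ ≤ 1 / 4 := by rw [mul_comm, he]; exact he4

theorem coolingTime_mul_quietProb_le {c : ℝ} (hc : 0 < c) {st : State n}
    (h : ∀ u, (st u).Valid) :
    (coolingTime (congestion c / 2) st : ℝ) * quietProb c st ≤ 1 / 4 := by
  refine le_trans ?_ (coolingTime_pow_mul_quietProb_le hc h)
  refine mul_le_mul_of_nonneg_right ?_ (quietProb_nonneg c st)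
  exact_mod_cast Nat.le_self_pow (by norm_num) _

theorem measureReal_dataEmpty (c : ℝ) (dec : Decision n) (st : State n) :
    (volume : Measure (SlotCoins n)).real {x | DataEmpty dec (broadcasts c st x)} =
      if dec.jamData then 0 else silenceProb st := by
  cases hj : dec.jamData
  · simp [DataEmpty, hj, measureReal_data_eq_empty]
  · simp [DataEmpty, hj]

theorem measureReal_controlEmpty {c : ℝ} (hc : 0 < c) (dec : Decision n) (st : State n) :
    (volume : Measure (SlotCoins n)).real {x | ControlEmpty dec (broadcasts c st x)} =
      if dec.jamControl then 0 else quietProb c st := by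
  cases hj : dec.jamControl
  · simp [ControlEmpty, hj, measureReal_control_eq_empty hc, quietProb]
  · simp [ControlEmpty, hj]

theorem measureReal_exists_succeeds_ge (c : ℝ) (dec : Decision n) (st : State n) :
    (if dec.jamData then 0 else contention st * silenceProb st) ≤
    (volume : Measure (SlotCoins n)).real {x | ∃ u, Succeeds dec (broadcasts c st x) u} := by
  cases hj : dec.jamData
  · simpa [Succeeds, hj] using measureReal_exists_data_eq_singleton_ge c st
  · simp

open Classical in
theorem integral_potentialChange (c : ℝ) (dec : Decision n) (st : State n) :
    ∫ x, potentialChange c dec st (broadcasts c st x) =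
      -successWeight c * (volume : Measure (SlotCoins n)).real
          {x | ∃ u, Succeeds dec (broadcasts c st x) u}
      + 32 / 15 * wakeWeight c * contention st *
        (volume : Measure (SlotCoins n)).real {x | DataEmpty dec (broadcasts c st x)}
      - (if 1 ≤ coolingTime (congestion c) st then 1 else 0)
      + (coolingTime (congestion c / 2) st
          - (if 1 ≤ numInactive st then 1 else 0) / congestion c) *
        (volume : Measure (SlotCoins n)).real {x | ControlEmpty dec (broadcasts c st x)}
      + (1 / 32) * (15 - (15 + if 1 ≤ maxGap st then 1 else 0) *
        (volume : Measure (SlotCoins n)).real {x | DataEmpty dec (broadcasts c st x)}) := by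
  rw [← integral_broadcasts_ite c st (fun r => ∃ u, Succeeds dec r u),
    ← integral_broadcasts_ite c st (DataEmpty dec),
    ← integral_broadcasts_ite c st (ControlEmpty dec)]
  have i1 := integrable_broadcasts c st fun r => if ∃ u, Succeeds dec r u then (1 : ℝ) else 0
  have i2 := integrable_broadcasts c st fun r => if DataEmpty dec r then (1 : ℝ) else 0
  have i3 := integrable_broadcasts c st fun r => if ControlEmpty dec r then (1 : ℝ) else 0
  have h : ∀ x, potentialChange c dec st (broadcasts c st x) =
      -successWeight c * (if ∃ u, Succeeds dec (broadcasts c st x) u then 1 else 0)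
      + (32 / 15 * wakeWeight c * contention st
          - (1 / 32) * (15 + if 1 ≤ maxGap st then 1 else 0)) *
        (if DataEmpty dec (broadcasts c st x) then 1 else 0)
      + (coolingTime (congestion c / 2) st
          - (if 1 ≤ numInactive st then 1 else 0) / congestion c) *
        (if ControlEmpty dec (broadcasts c st x) then 1 else 0)
      + (15 / 32 - (if 1 ≤ coolingTime (congestion c) st then 1 else 0)) := by
    intro x
    unfold potentialChange
    by_cases hd : DataEmpty dec (broadcasts c st x) <;> by_cases hg : 1 ≤ maxGap st <;>
      simp only [hd, hg, and_self, and_true, and_false, if_true, if_false] <;>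
      ring
  simp only [h]
  rw [integral_linear_combination i1 i2 i3]
  ring_nf

theorem wakeWeight_term_le (c : ℝ) (st : State n) :
    32 * Real.exp (2 * congestion c) * (contention st * silenceProb st) ≤
      successWeight c * (contention st * silenceProb st)
        - 32 / 15 * wakeWeight c * contention st * silenceProb st := by
  have h := wakeWeight_le_two c
  have hx : 0 ≤ contention st * silenceProb st :=
    mul_nonneg (contention_nonneg st) (silenceProb_nonneg st)
  unfold successWeight
  nlinarith

/-- The bound holds whatever the adversary disrupts: apart from the growth of the gap, the potential
increases only if one of the channels is empty, which a disruption prevents. On an undisrupted data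
channel the increase is offset by the chance of a success. -/
theorem integral_potentialChange_le_one {c : ℝ} (hc : 0 < c) (dec : Decision n) {st : State n}
    (h : ∀ u, (st u).Valid) :
    ∫ x, potentialChange c dec st (broadcasts c st x) ≤ 1 := by
  classical
  rw [integral_potentialChange, measureReal_dataEmpty, measureReal_controlEmpty hc]
  have hs := mul_le_mul_of_nonneg_left (measureReal_exists_succeeds_ge c dec st)
    (successWeight_pos c).le
  have hcool := coolingTime_mul_quietProb_le hc h
  have hq := quietProb_nonneg c st
  have hp := silenceProb_nonneg st
  have hx : 0 ≤ contention st * silenceProb st := mul_nonneg (contention_nonneg st) hp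
  have hw := wakeWeight_term_le c st
  have hw' : 0 ≤ 32 * Real.exp (2 * congestion c) * (contention st * silenceProb st) := by
    positivity
  have h1 : (0 : ℝ) ≤ if 1 ≤ coolingTime (congestion c) st then 1 else 0 := by
    split_ifs <;> norm_num
  have h2 : (0 : ℝ) ≤ (if 1 ≤ numInactive st then 1 else 0) / congestion c := by
    have := congestion_pos c
    positivity
  have h3 : (coolingTime (congestion c / 2) st -
      (if 1 ≤ numInactive st then 1 else 0) / congestion c) *
      (if dec.jamControl then 0 else quietProb c st) ≤ 1 / 4 := by
    have h0 := mul_nonneg h2 hq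
    cases dec.jamControl
    · simp only [Bool.false_eq_true, if_false]
      rw [sub_mul]
      linarith
    · norm_num
  have h4 : (0 : ℝ) ≤ (15 + if 1 ≤ maxGap st then 1 else 0) *
      (if dec.jamData then 0 else silenceProb st) := by positivity
  have h5 : 32 / 15 * wakeWeight c * contention st * (if dec.jamData then 0 else silenceProb st)
      ≤ successWeight c * (if dec.jamData then 0 else contention st * silenceProb st) := by
    split_ifs
    · simp
    · linarith
  linarith

/-- The rate at which the potential decreases in expectation in slots that are not disrupted. -/
def drift (c : ℝ) : ℝ := min (1 / 64) (1 / congestion c)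

theorem drift_pos (c : ℝ) : 0 < drift c :=
  lt_min (by norm_num) (div_pos one_pos (congestion_pos c))

theorem drift_le (c : ℝ) : drift c ≤ 1 / 64 := min_le_left _ _

theorem quietProb_eq_one (c : ℝ) {st : State n} (h : ∀ u s e, st u ≠ .active s e) :
    quietProb c st = 1 := by
  refine Finset.prod_eq_one fun u _ => ?_
  rcases hu : st u with _ | _ | ⟨s, e⟩ | _
  · simp [Status.controlProb]
  · simp [Status.controlProb]
  · exact absurd hu (h u s e)
  · simp [Status.controlProb]

theorem contention_eq_zero {st : State n} (h : ∀ u s e, st u ≠ .active s e) :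
    contention st = 0 := by
  refine Finset.sum_eq_zero fun u _ => ?_
  rcases hu : st u with _ | _ | ⟨s, e⟩ | _
  · simp [Status.dataProb]
  · simp [Status.dataProb]
  · exact absurd hu (h u s e)
  · simp [Status.dataProb]

/-- The negative drift of the potential. The four cases are a congested data channel, moderate
contention, little contention, and no active packets. -/
theorem integral_potentialChange_le_neg_drift {c : ℝ} (hc : 0 < c) {dec : Decision n}
    {st : State n} (h : ∀ u, (st u).Valid) (hlive : ∃ u, (st u).IsLive)
    (hd : dec.jamData = false) (hctl : dec.jamControl = false) :
    ∫ x, potentialChange c dec st (broadcasts c st x) ≤ -drift c := by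
  classical
  have hs := mul_le_mul_of_nonneg_left (measureReal_exists_succeeds_ge c dec st)
    (successWeight_pos c).le
  rw [integral_potentialChange, measureReal_dataEmpty, measureReal_controlEmpty hc]
  simp only [hd, hctl, Bool.false_eq_true, if_false] at hs ⊢
  have hcool := coolingTime_mul_quietProb_le hc h
  have hq := quietProb_nonneg c st
  have hp := silenceProb_nonneg st
  have hx : 0 ≤ contention st * silenceProb st := mul_nonneg (contention_nonneg st) hp
  have hw := wakeWeight_term_le c st
  have hw' : 0 ≤ 32 * Real.exp (2 * congestion c) * (contention st * silenceProb st) := by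
    positivity
  have hK := congestion_pos c
  have hK1 := one_le_congestion c
  have hdr := drift_le c
  have h2 : (0 : ℝ) ≤ (if 1 ≤ numInactive st then 1 else 0) / congestion c * quietProb c st := by
    positivity
  have h4 : (0 : ℝ) ≤ (15 + if 1 ≤ maxGap st then 1 else 0) * silenceProb st := by positivity
  have h1 : (0 : ℝ) ≤ if 1 ≤ coolingTime (congestion c) st then 1 else 0 := by
    split_ifs <;> norm_num
  rw [sub_mul (coolingTime (congestion c / 2) st : ℝ)]
  rcases lt_or_ge (congestion c) (contention st) with hX | hX
  · -- In a congested slot the cooling time decreases by one.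
    have : 1 ≤ coolingTime (congestion c) st := by
      by_contra hlt
      exact absurd (contention_le_of_coolingTime_eq_zero h hK (by omega)) (not_le.2 hX)
    simp only [this, if_true]
    linarith
  · rcases le_or_gt (1 / 32) (contention st) with hX' | hX'
    · -- With moderate contention a success is likely enough.
      have he : Real.exp (-2 * congestion c) ≤ silenceProb st :=
        (Real.exp_le_exp.2 (by linarith)).trans (exp_le_silenceProb st)
      have h5 : 1 ≤ 32 * Real.exp (2 * congestion c) * (contention st * silenceProb st) := by
        have h6 : 1 / 32 * Real.exp (-2 * congestion c) ≤ contention st * silenceProb st :=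
          mul_le_mul hX' he (Real.exp_pos _).le (contention_nonneg st)
        have h7 := mul_le_mul_of_nonneg_left h6
          (by positivity : 0 ≤ 32 * Real.exp (2 * congestion c))
        have h8 : 32 * Real.exp (2 * congestion c) * (1 / 32 * Real.exp (-2 * congestion c)) =
            Real.exp (2 * congestion c) * Real.exp (-2 * congestion c) := by ring
        rw [h8, ← Real.exp_add] at h7
        simpa using h7
      linarith
    · have hcool0 : coolingTime (congestion c / 2) st = 0 :=
        coolingTime_eq_zero (by linarith)
      have hsil := one_sub_contention_le_silenceProb st
      simp only [hcool0, Nat.cast_zero, zero_mul]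
      by_cases hact : ∃ u s e, st u = .active s e
      · -- With low contention most data slots are empty.
        obtain ⟨u, s, e, hu⟩ := hact
        have hgap : 1 ≤ maxGap st := by
          refine le_trans ?_ (gap_le_maxGap st u)
          have hv := h u
          rw [hu] at hv ⊢
          rcases hv.2 with ⟨rfl, rfl⟩ | h3
          · have : (st u).dataProb ≤ contention st :=
              Finset.single_le_sum (f := fun u => (st u).dataProb)
                (fun v _ => (st v).dataProb_nonneg) (Finset.mem_univ u)
            rw [hu] at this
            norm_num [Status.dataProb] at this
            linarith
          · simp only [Status.gap]; omega
        simp only [hgap, if_true]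
        linarith
      · -- Without active packets, the inactive packets become active.
        push Not at hact
        obtain ⟨u, hu⟩ := hlive
        have hin : 1 ≤ numInactive st := by
          refine Finset.card_pos.2 ⟨u, Finset.mem_filter.2 ⟨Finset.mem_univ _, ?_⟩⟩
          rcases hu' : st u with _ | _ | ⟨s, e⟩ | _
          · rw [hu'] at hu; exact hu.elim
          · rfl
          · exact absurd hu' (hact u s e)
          · rw [hu'] at hu; exact hu.elim
        rw [contention_eq_zero hact] at hsil
        have hdr' : drift c ≤ 1 / congestion c := min_le_right _ _
        have hg0 : (0 : ℝ) ≤ if 1 ≤ maxGap st then 1 else 0 := by split_ifs <;> norm_num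
        simp only [hin, if_true, quietProb_eq_one c hact] at hs ⊢
        nlinarith

/-- A bound for the fourth moment of the change of the potential. -/
def fourthMoment (c : ℝ) : ℝ := 64 * ((successWeight c + 6) ^ 4 + 15001)

open Classical in
theorem abs_potentialChange_le (c : ℝ) (dec : Decision n) (st : State n) (r : SlotRecord n) :
    |potentialChange c dec st r| ≤ successWeight c + 3
      + 5 * contention st * (if DataEmpty dec r then 1 else 0)
      + coolingTime (congestion c / 2) st * (if ControlEmpty dec r then 1 else 0) := by
  have hα := successWeight_pos c
  have hw := wakeWeight_pos c
  have hw2 := wakeWeight_le_two c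
  have hX := contention_nonneg st
  have hK := congestion_pos c
  have hK1 : 1 / congestion c ≤ 1 := (div_le_one hK).2 (one_le_congestion c)
  have hK0 : 0 < 1 / congestion c := by positivity
  have h1 : 32 / 15 * wakeWeight c * contention st ≤ 5 * contention st := by nlinarith
  have h2 : 0 ≤ 32 / 15 * wakeWeight c * contention st := by positivity
  have hind : ∀ (p : Prop) [Decidable p], (0 : ℝ) ≤ (if p then 1 else 0) ∧
      (if p then (1 : ℝ) else 0) ≤ 1 := by
    intro p _; split_ifs <;> norm_num
  have t1 := hind (∃ u, Succeeds dec r u)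
  have t3 := hind (1 ≤ coolingTime (congestion c) st)
  have t4 := hind (DataEmpty dec r ∧ 1 ≤ maxGap st)
  have t5 := hind (DataEmpty dec r)
  have t6 := hind (ControlEmpty dec r)
  have t7 : 0 ≤ (if 1 ≤ numInactive st then (1 : ℝ) else 0) / congestion c ∧
      (if 1 ≤ numInactive st then (1 : ℝ) else 0) / congestion c ≤ 1 := by
    split_ifs
    · exact ⟨hK0.le, hK1⟩
    · norm_num
  have t8 : (if DataEmpty dec r then (0 : ℝ) else 1) = 1 - (if DataEmpty dec r then 1 else 0) := by
    split_ifs <;> norm_num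
  unfold potentialChange
  rw [t8]
  generalize (if ∃ u, Succeeds dec r u then (1 : ℝ) else 0) = p1 at *
  generalize (if 1 ≤ coolingTime (congestion c) st then (1 : ℝ) else 0) = p3 at *
  generalize (if DataEmpty dec r ∧ 1 ≤ maxGap st then (1 : ℝ) else 0) = p4 at *
  generalize (if DataEmpty dec r then (1 : ℝ) else 0) = p5 at *
  generalize (if ControlEmpty dec r then (1 : ℝ) else 0) = p6 at *
  generalize (if 1 ≤ numInactive st then (1 : ℝ) else 0) / congestion c = p7 at *
  have h3 : (0 : ℝ) ≤ coolingTime (congestion c / 2) st := Nat.cast_nonneg _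
  have m1 : successWeight c * p1 ≤ successWeight c := mul_le_of_le_one_right hα.le t1.2
  have m1' : 0 ≤ successWeight c * p1 := mul_nonneg hα.le t1.1
  have m2 := mul_le_mul_of_nonneg_right h1 t5.1
  have m2' := mul_nonneg h2 t5.1
  have m3 : 0 ≤ p7 * p6 := mul_nonneg t7.1 t6.1
  have m3' : p7 * p6 ≤ 1 := mul_le_one₀ t7.2 t6.1 t6.2
  have m4 := mul_nonneg h3 t6.1
  rw [abs_le]
  constructor <;> linarith

/-- The change of the potential has a bounded fourth moment, as `contention` and `coolingTime` enter
it only in events of correspondingly small probability. The shift `δ` allows for the changes of the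
numbers of slots and of disrupted slots. -/
theorem integral_potentialChange_pow_le {c : ℝ} (hc : 0 < c) (dec : Decision n) {st : State n}
    (h : ∀ u, (st u).Valid) {δ : ℝ} (hδ : |δ| ≤ 3) :
    ∫ x, (potentialChange c dec st (broadcasts c st x) + δ) ^ 4 ≤ fourthMoment c := by
  classical
  have hX := contention_nonneg st
  have hα := successWeight_pos c
  -- The term `0 * 0` fills a place in `integral_linear_combination`.
  have hpt : ∀ r, (potentialChange c dec st r + δ) ^ 4 ≤
      0 * 0
      + 64 * (5 * contention st) ^ 4 * (if DataEmpty dec r then 1 else 0)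
      + 64 * (coolingTime (congestion c / 2) st : ℝ) ^ 4 *
        (if ControlEmpty dec r then 1 else 0) + 64 * (successWeight c + 6) ^ 4 := by
    intro r
    set A := successWeight c + 6
    set B := 5 * contention st * (if DataEmpty dec r then 1 else 0) with hB
    set C := (coolingTime (congestion c / 2) st : ℝ) * (if ControlEmpty dec r then 1 else 0) with hC
    have hA0 : 0 ≤ A := by positivity
    have hB0 : 0 ≤ B := by positivity
    have hC0 : 0 ≤ C := by positivity
    have h1 : |potentialChange c dec st r + δ| ≤ A + (B + C) := by
      refine (abs_add_le _ _).trans ?_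
      have := abs_potentialChange_le c dec st r
      linarith
    have h2 : (potentialChange c dec st r + δ) ^ 4 ≤ (A + (B + C)) ^ 4 := by
      rw [← Even.pow_abs (by decide : Even 4)]
      gcongr
    have h3 := add_pow_le hA0 (by positivity : 0 ≤ B + C) 4
    have h4 := add_pow_le hB0 hC0 4
    have h5 : B ^ 4 = (5 * contention st) ^ 4 * (if DataEmpty dec r then 1 else 0) := by
      rw [hB]; split_ifs <;> simp
    have h6 : C ^ 4 = (coolingTime (congestion c / 2) st : ℝ) ^ 4 *
        (if ControlEmpty dec r then 1 else 0) := by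
      rw [hC]; split_ifs <;> simp
    norm_num at h3 h4
    have : 0 ≤ A ^ 4 := by positivity
    rw [mul_assoc, mul_assoc, ← h5, ← h6]
    linarith
  have i2 := integrable_broadcasts c st fun r => if DataEmpty dec r then (1 : ℝ) else 0
  have i3 := integrable_broadcasts c st fun r => if ControlEmpty dec r then (1 : ℝ) else 0
  have i0 := integrable_broadcasts c st fun r =>
    0 * 0 + 64 * (5 * contention st) ^ 4 * (if DataEmpty dec r then (1 : ℝ) else 0)
      + 64 * (coolingTime (congestion c / 2) st : ℝ) ^ 4 *
        (if ControlEmpty dec r then 1 else 0) + 64 * (successWeight c + 6) ^ 4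
  refine (integral_mono (integrable_broadcasts c st fun r => (potentialChange c dec st r + δ) ^ 4)
    i0 fun x => hpt (broadcasts c st x)).trans ?_
  rw [integral_linear_combination (f₁ := fun _ => 0) (integrable_const _) i2 i3,
    integral_broadcasts_ite c st (DataEmpty dec),
    integral_broadcasts_ite c st (ControlEmpty dec), measureReal_dataEmpty,
    measureReal_controlEmpty hc]
  have h1 : (5 * contention st) ^ 4 * (if dec.jamData then 0 else silenceProb st) ≤ 15000 := by
    have hfac := Real.pow_div_factorial_le_exp (contention st) hX 4
    have hle : (5 * contention st) ^ 4 * silenceProb st ≤ 15000 := by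
      have h2 : contention st ^ 4 ≤ 24 * Real.exp (contention st) := by
        rw [div_le_iff₀ (by positivity)] at hfac
        norm_num [Nat.factorial] at hfac
        linarith
      calc (5 * contention st) ^ 4 * silenceProb st
          ≤ (5 * contention st) ^ 4 * Real.exp (-contention st) := by
            gcongr
            exact silenceProb_le_exp st
        _ = 625 * (contention st ^ 4 * Real.exp (-contention st)) := by ring
        _ ≤ 625 * (24 * Real.exp (contention st) * Real.exp (-contention st)) := by gcongr
        _ = 15000 := by rw [mul_assoc, ← Real.exp_add]; norm_num
    split_ifs
    · simp
    · exact hle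
  have h2 : (coolingTime (congestion c / 2) st : ℝ) ^ 4 *
      (if dec.jamControl then 0 else quietProb c st) ≤ 1 := by
    have := coolingTime_pow_mul_quietProb_le hc h
    split_ifs
    · simp
    · linarith
  unfold fourthMoment
  linarith

end

/-! ### The execution as a Markov chain -/

instance : Countable Status := by
  let code : Status → ℕ × ℕ × ℕ := fun
    | .pending => (0, 0, 0)
    | .inactive => (1, 0, 0)
    | .active s e => (2, s, e)
    | .done => (3, 0, 0)
  refine Function.Injective.countable (f := code) fun a b h => ?_
  cases a <;> cases b <;> simp_all [code]

/-- A snapshot of the execution at the beginning of a slot: the states of the packets, the records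
of the earlier slots, and how many earlier slots belonged to the execution and were disrupted,
respectively. -/
structure Snapshot (n : ℕ) where
  state : State n
  hist : List (SlotRecord n)
  live : ℕ
  disrupted : ℕ

section

variable {n : ℕ}

instance : IsProbabilityMeasure (coinMeasure n) := by unfold coinMeasure; infer_instance

instance : MeasurableSpace (Snapshot n) := ⊤

instance : DiscreteMeasurableSpace (Snapshot n) := ⟨fun _ => trivial⟩

instance : Countable (Snapshot n) := by
  refine Function.Injective.countable
    (f := fun s : Snapshot n => (s.state, s.hist, s.live, s.disrupted)) fun s s' h => ?_
  cases s; cases s'; simpa using h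

/-- The state during the slot, after the injections. -/
def Snapshot.current (A : Adversary n) (s : Snapshot n) : State n := arrive s.state (A s.hist)

/-- The slot belongs to the execution. -/
def Snapshot.IsLive (A : Adversary n) (s : Snapshot n) : Prop := ∃ u, (s.current A u).IsLive

/-- The slot is a disrupted slot of the execution. -/
def Snapshot.IsDisrupted (A : Adversary n) (s : Snapshot n) : Prop :=
  s.IsLive A ∧ ((A s.hist).jamData = true ∨ (A s.hist).jamControl = true)

open Classical in
/-- The snapshot after a slot with the record `r`. -/
def Snapshot.advance (A : Adversary n) (s : Snapshot n) (r : SlotRecord n) : Snapshot n where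
  state := step (A s.hist) (s.current A) r
  hist := r :: s.hist
  live := s.live + if s.IsLive A then 1 else 0
  disrupted := s.disrupted + if s.IsDisrupted A then 1 else 0

/-- The snapshot after a slot with the random numbers `x`. -/
def Snapshot.next (c : ℝ) (A : Adversary n) (s : Snapshot n) (x : SlotCoins n) : Snapshot n :=
  s.advance A (broadcasts c (s.current A) x)

/-- The snapshot at the beginning of the first slot. -/
def Snapshot.initial : Snapshot n := ⟨fun _ => .pending, [], 0, 0⟩

theorem Snapshot.measurable_next (c : ℝ) (A : Adversary n) (s : Snapshot n) :
    Measurable (s.next c A) :=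
  (measurable_of_countable (s.advance A)).comp (measurable_broadcasts c _)

/-- The snapshot at the beginning of slot `t`. -/
def snapshotAt (c : ℝ) (A : Adversary n) (ω : Coins n) (t : ℕ) : Snapshot n :=
  trajectory (Snapshot.next c A) Snapshot.initial ω t

theorem measurable_snapshotAt (c : ℝ) (A : Adversary n) (t : ℕ) :
    Measurable fun ω => snapshotAt c A ω t :=
  measurable_trajectory (Snapshot.measurable_next c A) _ t

theorem snapshotAt_succ (c : ℝ) (A : Adversary n) (ω : Coins n) (t : ℕ) :
    snapshotAt c A ω (t + 1) = (snapshotAt c A ω t).next c A (ω t) := rfl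

theorem snapshotAt_state_hist (c : ℝ) (A : Adversary n) (ω : Coins n) (t : ℕ) :
    (snapshotAt c A ω t).state = (config c A ω t).1 ∧
      (snapshotAt c A ω t).hist = (config c A ω t).2 := by
  induction t with
  | zero => exact ⟨rfl, rfl⟩
  | succ t ih =>
    rw [snapshotAt_succ]
    simp only [Snapshot.next, Snapshot.advance, Snapshot.current, config, ih.1, ih.2, and_self]

theorem snapshotAt_current (c : ℝ) (A : Adversary n) (ω : Coins n) (t : ℕ) :
    (snapshotAt c A ω t).current A = slotState c A ω t := by
  obtain ⟨h1, h2⟩ := snapshotAt_state_hist c A ω t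
  simp only [Snapshot.current, h1, h2]
  rfl

theorem snapshotAt_decision (c : ℝ) (A : Adversary n) (ω : Coins n) (t : ℕ) :
    A (snapshotAt c A ω t).hist = decisionAt c A ω t := by
  rw [(snapshotAt_state_hist c A ω t).2]; rfl

theorem snapshotAt_isLive (c : ℝ) (A : Adversary n) (ω : Coins n) (t : ℕ) :
    (snapshotAt c A ω t).IsLive A ↔ t ∈ liveSlots c A ω := by
  simp only [Snapshot.IsLive, snapshotAt_current]
  rfl

theorem snapshotAt_isDisrupted (c : ℝ) (A : Adversary n) (ω : Coins n) (t : ℕ) :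
    (snapshotAt c A ω t).IsDisrupted A ↔ t ∈ disruptedSlots c A ω := by
  simp only [Snapshot.IsDisrupted, snapshotAt_isLive, snapshotAt_decision]
  rfl

open Classical in
theorem snapshotAt_live_eq_card (c : ℝ) (A : Adversary n) (ω : Coins n) (t : ℕ) :
    (snapshotAt c A ω t).live = ((Finset.range t).filter (· ∈ liveSlots c A ω)).card := by
  induction t with
  | zero => rfl
  | succ t ih =>
    rw [Finset.range_add_one, Finset.filter_insert, snapshotAt_succ]
    simp only [Snapshot.next, Snapshot.advance, snapshotAt_isLive, ih]
    split_ifs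
    · rw [Finset.card_insert_of_notMem (by simp)]
    · rfl

open Classical in
theorem snapshotAt_disrupted_eq_card (c : ℝ) (A : Adversary n) (ω : Coins n) (t : ℕ) :
    (snapshotAt c A ω t).disrupted =
      ((Finset.range t).filter (· ∈ disruptedSlots c A ω)).card := by
  induction t with
  | zero => rfl
  | succ t ih =>
    rw [Finset.range_add_one, Finset.filter_insert, snapshotAt_succ]
    simp only [Snapshot.next, Snapshot.advance, snapshotAt_isDisrupted, ih]
    split_ifs
    · rw [Finset.card_insert_of_notMem (by simp)]
    · rfl

theorem snapshotAt_disrupted_le {c : ℝ} {A : Adversary n} {ω : Coins n}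
    (h : (disruptedSlots c A ω).Finite) (t : ℕ) :
    (snapshotAt c A ω t).disrupted ≤ numDisrupted c A ω := by
  classical
  rw [snapshotAt_disrupted_eq_card, numDisrupted, ← Set.ncard_coe_finset]
  exact Set.ncard_le_ncard (fun i hi => (Finset.mem_filter.1 hi).2) h

theorem exists_forall_filter_range_card_eq {s : Set ℕ} [DecidablePred (· ∈ s)] (h : s.Finite) :
    ∃ T, ∀ t ≥ T, ((Finset.range t).filter (· ∈ s)).card = s.ncard := by
  obtain ⟨T, hT⟩ := h.bddAbove
  refine ⟨T + 1, fun t ht => ?_⟩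
  rw [← Set.ncard_coe_finset]
  congr 1
  ext i
  simp only [Finset.coe_filter, Finset.mem_range, Set.mem_ofPred_eq, and_iff_right_iff_imp]
  intro hi
  have := hT hi
  omega

/-- What every snapshot of an execution satisfies: the statuses obey the protocol, and the slots of
an active period belong to the execution. -/
def Snapshot.Valid (s : Snapshot n) : Prop :=
  ∀ u, (s.state u).Valid ∧ ∀ a e, s.state u = .active a e → a ≤ s.live + 1

theorem Snapshot.valid_initial : (Snapshot.initial : Snapshot n).Valid :=
  fun _ => ⟨trivial, fun _ _ h => by simp [Snapshot.initial] at h⟩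

theorem Snapshot.Valid.current {s : Snapshot n} (h : s.Valid) (A : Adversary n) (u : Fin n) :
    (s.current A u).Valid :=
  valid_arrive (fun u => (h u).1) _ u

theorem eq_active_of_arrive_eq_active {st : State n} {dec : Decision n} {u : Fin n} {a e : ℕ}
    (h : arrive st dec u = .active a e) : st u = .active a e := by
  unfold arrive at h
  rcases hu : st u with _ | _ | ⟨s, e⟩ | _ <;> simp only [hu] at h
  · split_ifs at h
  · simp at h
  · exact h
  · simp at h

theorem Snapshot.Valid.next {s : Snapshot n} (h : s.Valid) (c : ℝ) (A : Adversary n)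
    (x : SlotCoins n) : (s.next c A x).Valid := by
  intro u
  refine ⟨valid_step _ _ _ u, fun a e hae => ?_⟩
  simp only [Snapshot.next, Snapshot.advance] at hae ⊢
  rcases hu : s.current A u with _ | _ | ⟨a', e'⟩ | _
  · simp [step_pending hu] at hae
  · rw [step_inactive hu] at hae
    split_ifs at hae
    simp only [Status.active.injEq] at hae
    omega
  · have hl : s.IsLive A := ⟨u, by rw [hu]; trivial⟩
    have := (h u).2 a' e' (eq_active_of_arrive_eq_active hu)
    have ha : a = a' + 1 := by
      rw [step_active hu] at hae
      split_ifs at hae <;> simp only [Status.active.injEq] at hae <;> omega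
    simp only [hl, if_true]
    omega
  · simp [step_done hu] at hae

theorem valid_snapshotAt (c : ℝ) (A : Adversary n) (ω : Coins n) (t : ℕ) :
    (snapshotAt c A ω t).Valid := by
  induction t with
  | zero => exact Snapshot.valid_initial
  | succ t ih => exact ih.next c A (ω t)

/-- The potential method for executions, with a real potential `f` and a real bound for its
expected change in a slot. -/
theorem lintegral_potential_snapshot_le {c : ℝ} {A : Adversary n} {f gain : Snapshot n → ℝ}
    {cost : Snapshot n → SlotRecord n → ℝ}
    (hf : ∀ s, s.Valid → 0 ≤ f s) (hcost : ∀ s r, 0 ≤ cost s r) (hgain : ∀ s, 0 ≤ gain s)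
    (h : ∀ s : Snapshot n, s.Valid →
      ∫ x, (f (s.next c A x) + cost s (broadcasts c (s.current A) x)) ≤ f s + gain s) (T : ℕ) :
    ∫⁻ ω, (ENNReal.ofReal (f (snapshotAt c A ω T)) +
        ∑ t ∈ Finset.range T, ENNReal.ofReal (cost (snapshotAt c A ω t) (recordAt c A ω t)))
        ∂(coinMeasure n) ≤
      ENNReal.ofReal (f Snapshot.initial) +
        ∫⁻ ω, ∑ t ∈ Finset.range T, ENNReal.ofReal (gain (snapshotAt c A ω t))
          ∂(coinMeasure n) := by
  have key := lintegral_potential_le (volume : Measure (SlotCoins n))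
    (Snapshot.measurable_next c A) Snapshot.Valid Snapshot.valid_initial
    (fun s x hs => hs.next c A x) (f := fun s => ENNReal.ofReal (f s))
    (gain := fun s => ENNReal.ofReal (gain s))
    (cost := fun s x => ENNReal.ofReal (cost s (broadcasts c (s.current A) x)))
    (fun s => ENNReal.measurable_ofReal.comp
      ((measurable_of_countable (cost s)).comp (measurable_broadcasts c _)))
    (fun s hs => by
      simp only [← ENNReal.ofReal_add (hf _ (hs.next c A _)) (hcost _ _)]
      change ∫⁻ x, ENNReal.ofReal (f (s.advance A (broadcasts c (s.current A) x))
        + cost s (broadcasts c (s.current A) x)) ≤ _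
      rw [← ofReal_integral_eq_lintegral_ofReal
        (integrable_broadcasts c (s.current A) fun r => f (s.advance A r) + cost s r)
        (Filter.Eventually.of_forall fun x => add_nonneg (hf _ (hs.next c A _)) (hcost _ _)),
        ← ENNReal.ofReal_add (hf s hs) (hgain s)]
      exact ENNReal.ofReal_le_ofReal (h s hs)) T
  have hrec : ∀ ω t, cost (snapshotAt c A ω t) (recordAt c A ω t) =
      cost (snapshotAt c A ω t) (broadcasts c ((snapshotAt c A ω t).current A) (ω t)) := by
    intro ω t
    rw [snapshotAt_current]; rfl
  simp only [hrec]
  exact key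

end

/-! ### The number of access attempts of a packet -/

/-- The expected number of access attempts of a packet in the first `j` slots of an active
period. -/
def accessSum (c : ℝ) (j : ℕ) : ℝ :=
  ∑ i ∈ Finset.range j,
    ((Status.active (i + 1) 0).dataProb + (Status.active (i + 1) 0).controlProb c)

theorem accessSum_mono {c : ℝ} (hc : 0 < c) : Monotone (accessSum c) :=
  monotone_nat_of_le_succ fun j => by
    rw [accessSum, accessSum, Finset.sum_range_succ]
    linarith [(Status.active (j + 1) 0).dataProb_nonneg,
      (Status.active (j + 1) 0).controlProb_nonneg hc]

theorem accessSum_nonneg {c : ℝ} (hc : 0 < c) (j : ℕ) : 0 ≤ accessSum c j :=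
  (accessSum_mono hc (Nat.zero_le j)).trans' (by simp [accessSum])

/-- A bound, up to a constant factor, for the expected number of future active periods of a packet.
It decreases by `3 / 4` when the packet becomes active. During an active period it grows with the
fraction `e / (s - 1)` of empty data slots, which is balanced in expectation by the decrease to `0`
at a success, and it is at least `2 + 15 / 16` when the packet becomes inactive. -/
def Status.retries : Status → ℝ
  | .pending => 11 / 4
  | .inactive => 11 / 4
  | .active s e => 2 + (e : ℝ) / ((s : ℝ) - 1)
  | .done => 0

/-- A bound for the expected number of future access attempts of a packet with the given status,
for an execution that ends after `l` slots. The factor `4 / 3` makes the decrease of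
`Status.retries` by `3 / 4` pay for a whole active period. -/
def Status.accessPotential (c : ℝ) (l : ℕ) (a : Status) : ℝ :=
  4 / 3 * a.retries * accessSum c l +
    match a with
    | .active s _ => accessSum c l - accessSum c (s - 1)
    | _ => 0

theorem Status.accessPotential_nonneg {c : ℝ} (hc : 0 < c) {l : ℕ} {a : Status} (ha : a.Valid)
    (hl : ∀ s e, a = .active s e → s ≤ l + 1) : 0 ≤ a.accessPotential c l := by
  have h := accessSum_nonneg hc l
  cases a with
  | active s e =>
    have h1 := ha.fraction_nonneg
    have h2 := accessSum_mono hc (Nat.sub_le_iff_le_add.2 (hl s e rfl))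
    simp only [Status.accessPotential, Status.retries]
    have : 0 ≤ 4 / 3 * (2 + (e : ℝ) / ((s : ℝ) - 1)) * accessSum c l := by positivity
    linarith
  | _ => simp only [Status.accessPotential, Status.retries]; positivity

section

variable {n : ℕ}

open Classical in
theorem accessPotential_step_active_le {c : ℝ} (hc : 0 < c) {dec : Decision n} {st : State n}
    {u : Fin n} {s e l : ℕ} (hu : st u = .active s e) (hv : (Status.active s e).Valid)
    (hl : s ≤ l + 1) (r : SlotRecord n) :
    (step dec st r u).accessPotential c (l + 1) ≤
      4 / 3 * accessSum c (l + 1) * ((2 + (e : ℝ) / s) * (1 - if Succeeds dec r u then 1 else 0)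
        + 1 / s * (if DataEmpty dec r then 1 else 0))
      + (accessSum c (l + 1) - accessSum c s) := by
  have hs : (1 : ℝ) ≤ s := by exact_mod_cast hv.1
  have hV := accessSum_nonneg hc (l + 1)
  have hVs := accessSum_mono hc hl
  rw [step_active hu]
  by_cases hsu : Succeeds dec r u
  · simp only [hsu, if_true, sub_self, mul_zero, Status.accessPotential, Status.retries, zero_mul,
      zero_add]
    have : 0 ≤ 4 / 3 * accessSum c (l + 1) * (1 / s * (if DataEmpty dec r then 1 else 0)) := by
      positivity
    linarith
  · simp only [hsu, if_false, sub_zero, mul_one]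
    have hfr : ((if DataEmpty dec r then e + 1 else e : ℕ) : ℝ) / s =
        (e : ℝ) / s + 1 / s * (if DataEmpty dec r then 1 else 0) := by
      split_ifs
      · push_cast; ring
      · ring
    rw [add_assoc, ← hfr]
    generalize (if DataEmpty dec r then e + 1 else e : ℕ) = e'
    split_ifs with hq
    · have : 15 / 16 ≤ (e' : ℝ) / s := by rw [le_div_iff₀ (by linarith)]; exact hq
      simp only [Status.accessPotential, Status.retries]
      nlinarith
    · simp only [Status.accessPotential, Status.retries, Nat.add_sub_cancel]
      have : ((s + 1 : ℕ) : ℝ) - 1 = s := by push_cast; ring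
      rw [this]
      linarith

theorem dataProb_mul_measureReal_dataEmpty_le (c : ℝ) (dec : Decision n) (st : State n)
    (u : Fin n) :
    (st u).dataProb *
        (volume : Measure (SlotCoins n)).real {x | DataEmpty dec (broadcasts c st x)} ≤
      (volume : Measure (SlotCoins n)).real {x | Succeeds dec (broadcasts c st x) u} := by
  rw [measureReal_dataEmpty]
  cases hj : dec.jamData
  · simpa [Succeeds, hj] using measureReal_data_eq_singleton_ge c st u
  · simp

open Classical in
/-- The number of channels on which `u` broadcasts in a slot. -/
def slotAttempts (u : Fin n) (r : SlotRecord n) : ℝ :=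
  (if u ∈ r.data then 1 else 0) + (if u ∈ r.control then 1 else 0)

theorem slotAttempts_nonneg (u : Fin n) (r : SlotRecord n) : 0 ≤ slotAttempts u r := by
  unfold slotAttempts; positivity

theorem integral_slotAttempts {c : ℝ} (hc : 0 < c) (st : State n) (u : Fin n) :
    ∫ x, slotAttempts u (broadcasts c st x) = (st u).dataProb + (st u).controlProb c := by
  classical
  unfold slotAttempts
  rw [integral_add (integrable_broadcasts c st fun r => if u ∈ r.data then 1 else 0)
    (integrable_broadcasts c st fun r => if u ∈ r.control then 1 else 0),
    ← measureReal_mem_data c st u, ← measureReal_mem_control hc st u,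
    ← integral_broadcasts_ite c st (fun r => u ∈ r.data),
    ← integral_broadcasts_ite c st (fun r => u ∈ r.control)]

theorem integral_accessPotential_active_le {c : ℝ} (hc : 0 < c) (dec : Decision n) {st : State n}
    {u : Fin n} {s e l : ℕ} (hu : st u = .active s e) (hv : (Status.active s e).Valid)
    (hl : s ≤ l + 1) :
    ∫ x, ((step dec st (broadcasts c st x) u).accessPotential c (l + 1)
        + slotAttempts u (broadcasts c st x)) ≤
      (Status.active s e).accessPotential c l + 5 * (accessSum c (l + 1) - accessSum c l) := by
  classical
  have i0 := integrable_broadcasts c st fun r => (step dec st r u).accessPotential c (l + 1)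
  have i1 := integrable_broadcasts c st fun r => if Succeeds dec r u then (1 : ℝ) else 0
  have i2 := integrable_broadcasts c st fun r => if DataEmpty dec r then (1 : ℝ) else 0
  set V := accessSum c (l + 1) with hVdef
  have hV : 0 ≤ V := accessSum_nonneg hc (l + 1)
  have hVl : accessSum c l ≤ V := accessSum_mono hc (Nat.le_succ l)
  have hs : (1 : ℝ) ≤ s := by exact_mod_cast hv.1
  have hfrac := hv.fraction_nonneg
  have hfrac1 : (e : ℝ) / ((s : ℝ) - 1) ≤ 1 := by
    rcases hv.2 with ⟨rfl, rfl⟩ | h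
    · simp
    · have h1 : e + 1 ≤ s := by omega
      have h2 : (e : ℝ) + 1 ≤ s := by exact_mod_cast h1
      exact div_le_one_of_le₀ (by linarith) (by linarith)
  have hes : (e : ℝ) / s ≤ (e : ℝ) / ((s : ℝ) - 1) := by
    rcases hv.2 with ⟨_, rfl⟩ | h
    · simp
    · have : 1 < s := by omega
      have : (1 : ℝ) < s := by exact_mod_cast this
      exact div_le_div_of_nonneg_left (Nat.cast_nonneg _) (by linarith) (by linarith)
  rw [integral_add i0 (integrable_broadcasts c st (slotAttempts u)), integral_slotAttempts hc]
  have hle : ∫ x, (step dec st (broadcasts c st x) u).accessPotential c (l + 1) ≤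
      4 / 3 * V * (2 + (e : ℝ) / s) + (V - accessSum c s) := by
    -- The term `0 * 0` fills a place in `integral_linear_combination`.
    have hpt : ∀ r : SlotRecord n, (step dec st r u).accessPotential c (l + 1) ≤
        -(4 / 3 * V * (2 + (e : ℝ) / s)) * (if Succeeds dec r u then 1 else 0)
        + 4 / 3 * V * (1 / s) * (if DataEmpty dec r then 1 else 0) + 0 * 0
        + (4 / 3 * V * (2 + (e : ℝ) / s) + (V - accessSum c s)) := fun r => by
      have := accessPotential_step_active_le hc (dec := dec) hu hv hl r
      linarith
    refine (integral_mono i0 (integrable_broadcasts c st fun r =>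
        -(4 / 3 * V * (2 + (e : ℝ) / s)) * (if Succeeds dec r u then 1 else 0)
        + 4 / 3 * V * (1 / s) * (if DataEmpty dec r then 1 else 0) + 0 * 0
        + (4 / 3 * V * (2 + (e : ℝ) / s) + (V - accessSum c s)))
      fun x => hpt (broadcasts c st x)).trans ?_
    rw [integral_linear_combination (f₃ := fun _ => 0) i1 i2 (integrable_const _),
      integral_broadcasts_ite c st (fun r => Succeeds dec r u),
      integral_broadcasts_ite c st (DataEmpty dec)]
    have hsucc := dataProb_mul_measureReal_dataEmpty_le c dec st u
    set pS := (volume : Measure (SlotCoins n)).real {x | Succeeds dec (broadcasts c st x) u}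
    set pE := (volume : Measure (SlotCoins n)).real {x | DataEmpty dec (broadcasts c st x)}
    -- An empty data slot is at most `2 s` times as likely as a success of the packet.
    have h2 : 1 / s * pE ≤ (2 + (e : ℝ) / s) * pS := by
      rw [hu, Status.dataProb] at hsucc
      have h3 : (1 : ℝ) / s * pE = 2 * (1 / 2 / (s : ℝ) * pE) := by ring
      have h4 : 0 ≤ (e : ℝ) / s := by positivity
      have h5 : 0 ≤ pS := measureReal_nonneg
      rw [h3]
      nlinarith
    have h6 := mul_le_mul_of_nonneg_left h2 (by positivity : 0 ≤ 4 / 3 * V)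
    linarith
  have hsum : accessSum c s = accessSum c (s - 1) +
      ((Status.active s e).dataProb + (Status.active s e).controlProb c) := by
    obtain ⟨j, rfl⟩ : ∃ j, s = j + 1 := ⟨s - 1, by have := hv.1; omega⟩
    rw [accessSum, Finset.sum_range_succ]
    rfl
  have hpot : (Status.active s e).accessPotential c l =
      4 / 3 * (2 + (e : ℝ) / ((s : ℝ) - 1)) * accessSum c l
        + (accessSum c l - accessSum c (s - 1)) := rfl
  rw [hu, hpot]
  have h7 : 4 / 3 * V * (2 + (e : ℝ) / s) ≤ 4 / 3 * V * (2 + (e : ℝ) / ((s : ℝ) - 1)) := by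
    gcongr
  have h8 : (2 + (e : ℝ) / ((s : ℝ) - 1)) * (V - accessSum c l) ≤ 3 * (V - accessSum c l) :=
    mul_le_mul_of_nonneg_right (by linarith) (by linarith)
  linarith

theorem slotAttempts_eq_zero {c : ℝ} {st : State n} {u : Fin n} (h : ∀ s e, st u ≠ .active s e)
    (x : SlotCoins n) : slotAttempts u (broadcasts c st x) = 0 := by
  have h0 := unitInterval.nonneg (x u).1
  have h1 := unitInterval.nonneg (x u).2
  unfold slotAttempts
  simp only [mem_data_iff, mem_control_iff]
  rcases hu : st u with _ | _ | ⟨s, e⟩ | _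
  · simp [Status.dataProb, Status.controlProb, not_lt.2 h0, not_lt.2 h1]
  · simp [Status.dataProb, Status.controlProb, not_lt.2 h0, not_lt.2 h1]
  · exact absurd hu (h s e)
  · simp [Status.dataProb, Status.controlProb, not_lt.2 h0, not_lt.2 h1]

theorem accessPotential_arrive (c : ℝ) (l : ℕ) (st : State n) (dec : Decision n) (u : Fin n) :
    (arrive st dec u).accessPotential c l = (st u).accessPotential c l := by
  unfold arrive
  cases st u with
  | pending => dsimp only; split_ifs <;> rfl
  | _ => rfl

/-- The potential grows only with the length of the execution; the constant `5 = 4 / 3 * 3 + 1`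
comes from the bound `3` for `Status.retries` and from the current active period. -/
theorem integral_accessPotential_le {c : ℝ} (hc : 0 < c) (A : Adversary n) (u : Fin n)
    {s : Snapshot n} (hs : s.Valid) {l' : ℕ} (hl' : ∀ r, (s.advance A r).live = l') :
    ∫ x, (((s.next c A x).state u).accessPotential c (s.next c A x).live
        + slotAttempts u (broadcasts c (s.current A) x)) ≤
      (s.state u).accessPotential c s.live + 5 * (accessSum c l' - accessSum c s.live) := by
  classical
  rw [← accessPotential_arrive c s.live s.state (A s.hist) u]
  change ∫ x, ((step (A s.hist) (s.current A) (broadcasts c (s.current A) x) u).accessPotential c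
    (s.advance A (broadcasts c (s.current A) x)).live
    + slotAttempts u (broadcasts c (s.current A) x)) ≤
    (s.current A u).accessPotential c s.live + _
  simp only [hl']
  have hl'' : l' = s.live + if s.IsLive A then 1 else 0 := (hl' ⟨∅, ∅⟩).symm
  have hle : s.live ≤ l' := by omega
  have hVl := accessSum_mono hc hle
  have hconst : ∀ {a : ℝ} {f : SlotCoins n → ℝ}, Integrable f → (∀ x, f x ≤ a) → ∫ x, f x ≤ a :=
    fun {a f} hi h => (integral_mono hi (integrable_const a) h).trans (by simp)
  have hint := integrable_broadcasts c (s.current A) fun r =>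
    (step (A s.hist) (s.current A) r u).accessPotential c l' + slotAttempts u r
  rcases hu : s.current A u with _ | _ | ⟨a, e⟩ | _
  · refine hconst hint fun x => ?_
    rw [slotAttempts_eq_zero (by simp [hu]), step_pending hu]
    simp only [Status.accessPotential, Status.retries]
    linarith
  · refine hconst hint fun x => ?_
    rw [slotAttempts_eq_zero (by simp [hu]), step_inactive hu]
    split_ifs <;> simp only [Status.accessPotential, Status.retries]
    · simp [accessSum]
      simp [accessSum] at hVl
      linarith
    · linarith
  · have hlive : s.IsLive A := ⟨u, by rw [hu]; trivial⟩
    rw [if_pos hlive] at hl''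
    subst hl''
    have hv := hs.current A u
    rw [hu] at hv
    exact integral_accessPotential_active_le hc _ hu hv
      ((hs u).2 a e (eq_active_of_arrive_eq_active hu))
  · refine hconst hint fun x => ?_
    rw [slotAttempts_eq_zero (by simp [hu]), step_done hu]
    simp only [Status.accessPotential, Status.retries]
    linarith

/-- The expected number of access attempts of a packet is bounded by what a packet that is active
throughout the execution would need, up to a constant factor. -/
theorem lintegral_attempts_le {c : ℝ} (hc : 0 < c) (A : Adversary n) (u : Fin n) {B : ℝ≥0∞}
    (hB : ∀ T, ∫⁻ ω, ENNReal.ofReal (5 * accessSum c (snapshotAt c A ω T).live)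
      ∂(coinMeasure n) ≤ B) :
    ∫⁻ ω, attempts c A ω u ∂(coinMeasure n) ≤ B := by
  classical
  have hsl : ∀ ω t, ENNReal.ofReal (slotAttempts u (recordAt c A ω t)) =
      (if u ∈ (recordAt c A ω t).data then 1 else 0)
        + (if u ∈ (recordAt c A ω t).control then 1 else 0) := by
    intro ω t
    unfold slotAttempts
    split_ifs <;> norm_num
  have hpart : ∀ T, ∫⁻ ω, ∑ t ∈ Finset.range T,
      ENNReal.ofReal (slotAttempts u (recordAt c A ω t)) ∂(coinMeasure n) ≤ B := by
    intro T
    have key := lintegral_potential_snapshot_le (c := c) (A := A)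
      (f := fun s => (s.state u).accessPotential c s.live)
      (gain := fun s => 5 * (accessSum c (s.live + if s.IsLive A then 1 else 0)
        - accessSum c s.live))
      (cost := fun _ => slotAttempts u)
      (fun s hs => Status.accessPotential_nonneg hc (hs u).1 (hs u).2)
      (fun _ => slotAttempts_nonneg u)
      (fun s => by
        have := accessSum_mono hc (Nat.le_add_right s.live (if s.IsLive A then 1 else 0))
        linarith)
      (fun s hs => integral_accessPotential_le hc A u hs fun r => rfl) T
    refine (lintegral_mono fun ω => le_add_self).trans (key.trans ?_)
    have h0 : ((Snapshot.initial : Snapshot n).state u).accessPotential c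
        (Snapshot.initial : Snapshot n).live = 0 := by
      simp [Snapshot.initial, Status.accessPotential, accessSum]
    rw [h0, ENNReal.ofReal_zero, zero_add]
    refine le_trans (le_of_eq ?_) (hB T)
    refine lintegral_congr fun ω => ?_
    have hsucc : ∀ t, (snapshotAt c A ω t).live +
        (if (snapshotAt c A ω t).IsLive A then 1 else 0) = (snapshotAt c A ω (t + 1)).live :=
      fun t => rfl
    simp only [hsucc]
    rw [← ENNReal.ofReal_sum_of_nonneg, ← Finset.mul_sum,
      Finset.sum_range_sub fun t => accessSum c (snapshotAt c A ω t).live]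
    · congr 2
      simp [snapshotAt, trajectory, Snapshot.initial, accessSum]
    · intro t _
      have := accessSum_mono hc
        (Nat.le_add_right (snapshotAt c A ω t).live
          (if (snapshotAt c A ω t).IsLive A then 1 else 0))
      rw [hsucc] at this
      linarith
  have hmeas : ∀ t, Measurable fun ω : Coins n =>
      ENNReal.ofReal (slotAttempts u (recordAt c A ω t)) := by
    intro t
    have h1 : ∀ s : Snapshot n, Measurable fun x : SlotCoins n =>
        ENNReal.ofReal (slotAttempts u (broadcasts c (s.current A) x)) := fun s =>
      ENNReal.measurable_ofReal.comp
        ((measurable_of_countable (slotAttempts u)).comp (measurable_broadcasts c _))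
    have h2 := (measurable_uncurry_of_countable h1).comp
      ((measurable_snapshotAt c A t).prodMk (measurable_pi_apply t))
    have h3 : (fun ω : Coins n => ENNReal.ofReal (slotAttempts u (recordAt c A ω t))) =
        Function.uncurry (fun (s : Snapshot n) (x : SlotCoins n) =>
          ENNReal.ofReal (slotAttempts u (broadcasts c (s.current A) x))) ∘
        fun ω => (snapshotAt c A ω t, ω t) := by
      funext ω
      simp only [Function.comp, Function.uncurry, snapshotAt_current]
      rfl
    rw [h3]
    exact h2
  have hatt : ∀ ω, attempts c A ω u = ∑' t, ENNReal.ofReal (slotAttempts u (recordAt c A ω t)) := by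
    intro ω
    simp only [hsl]
    rfl
  simp only [hatt]
  rw [lintegral_tsum fun t => (hmeas t).aemeasurable]
  refine ENNReal.tsum_le_of_sum_range_le fun T => ?_
  rw [← lintegral_finsetSum _ fun t _ => hmeas t]
  exact hpart T

end

/-! ### The potential along an execution -/

section

variable {n : ℕ}

open Classical in
/-- An upper bound for the change of the potential of the state in a slot, which is `0` if the slot
does not belong to the execution. -/
def Snapshot.change (c : ℝ) (A : Adversary n) (s : Snapshot n) (r : SlotRecord n) : ℝ :=
  if s.IsLive A then potentialChange c (A s.hist) (s.current A) r else 0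

theorem step_eq_self_of_not_live {dec : Decision n} {st : State n} {r : SlotRecord n}
    (h : ¬ ∃ u, (st u).IsLive) : step dec st r = st := by
  push Not at h
  funext u
  have hu := h u
  rcases hst : st u with _ | _ | ⟨s, e⟩ | _
  · exact step_pending hst
  · rw [hst] at hu; exact absurd trivial hu
  · rw [hst] at hu; exact absurd trivial hu
  · exact step_done hst

theorem Snapshot.Valid.potential_next_le {s : Snapshot n} (hs : s.Valid) (c : ℝ)
    (A : Adversary n) (x : SlotCoins n) :
    potential c (s.next c A x).state ≤
      potential c s.state + s.change c A (broadcasts c (s.current A) x) := by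
  have h0 : potential c s.state = potential c (s.current A) := (potential_arrive c _ _).symm
  rw [h0]
  unfold Snapshot.change
  split_ifs with h
  · exact potential_step_le _ (hs.current A) x
  · rw [add_zero]
    exact (congrArg _ (step_eq_self_of_not_live h)).le

theorem Snapshot.Valid.potential_nonneg {s : Snapshot n} (hs : s.Valid) (c : ℝ) :
    0 ≤ potential c s.state :=
  ReBackoff.potential_nonneg fun u => (hs u).1

open Classical in
theorem Snapshot.Valid.integral_change_le {s : Snapshot n} (hs : s.Valid) {c : ℝ} (hc : 0 < c)
    (A : Adversary n) :
    ∫ x, s.change c A (broadcasts c (s.current A) x) ≤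
      (1 + drift c) * (if s.IsDisrupted A then 1 else 0)
        - drift c * (if s.IsLive A then 1 else 0) := by
  unfold Snapshot.change
  by_cases hl : s.IsLive A
  · simp only [hl, if_true]
    by_cases hd : s.IsDisrupted A
    · simp only [hd, if_true]
      linarith [integral_potentialChange_le_one hc (A s.hist) (hs.current A)]
    · simp only [hd, if_false]
      have hd' : (A s.hist).jamData = false ∧ (A s.hist).jamControl = false := by
        by_contra hcon
        exact hd ⟨hl, by
          cases h1 : (A s.hist).jamData <;> cases h2 : (A s.hist).jamControl <;> simp_all⟩
      linarith [integral_potentialChange_le_neg_drift hc (hs.current A) hl hd'.1 hd'.2]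
  · have hd : ¬ s.IsDisrupted A := fun h => hl h.1
    simp [hl, hd]

theorem potential_initial_le (c : ℝ) :
    potential c (Snapshot.initial : Snapshot n).state ≤ (successWeight c + 2) * n := by
  have h1 : coolingTime (congestion c) (Snapshot.initial : Snapshot n).state = 0 := by
    refine coolingTime_eq_zero (le_trans (le_of_eq ?_) (congestion_pos c).le)
    simp [contention, Snapshot.initial, Status.dataProb]
  have h2 : maxGap (Snapshot.initial : Snapshot n).state = 0 := by
    simp [maxGap, Snapshot.initial, Status.gap]
  have hw := wakeWeight_le_two c
  unfold potential
  rw [h1, h2]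
  simp only [Snapshot.initial, Status.bank, Finset.sum_const, Finset.card_univ, Fintype.card_fin,
    nsmul_eq_mul, Nat.cast_zero, mul_zero, add_zero]
  rw [mul_comm]
  gcongr

theorem integral_add_mul_change {s : Snapshot n} (c : ℝ) (A : Adversary n) (a b : ℝ) :
    ∫ x, (a + b * s.change c A (broadcasts c (s.current A) x)) =
      a + b * ∫ x, s.change c A (broadcasts c (s.current A) x) := by
  rw [integral_add (integrable_const _)
    ((integrable_broadcasts c (s.current A) (s.change c A)).const_mul b), integral_const_mul]
  simp

/-! ### The execution is finite -/

open Classical in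
/-- The expected number of slots that are not disrupted, before more than `d` slots have been
disrupted, is finite. -/
theorem lintegral_tsum_live_le {c : ℝ} (hc : 0 < c) (A : Adversary n) (d : ℕ) :
    ∫⁻ ω, ∑' t, ENNReal.ofReal (drift c *
        (if (snapshotAt c A ω t).IsLive A ∧ ¬ (snapshotAt c A ω t).IsDisrupted A ∧
          (snapshotAt c A ω t).disrupted ≤ d then 1 else 0)) ∂(coinMeasure n) ≤
      ENNReal.ofReal (potential c (Snapshot.initial : Snapshot n).state)
        + ENNReal.ofReal (d + 1) := by
  have hmeas : ∀ t, Measurable fun ω : Coins n => ENNReal.ofReal (drift c *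
        (if (snapshotAt c A ω t).IsLive A ∧ ¬ (snapshotAt c A ω t).IsDisrupted A ∧
          (snapshotAt c A ω t).disrupted ≤ d then 1 else 0)) := fun t =>
    (measurable_of_countable fun s : Snapshot n => ENNReal.ofReal (drift c *
        (if s.IsLive A ∧ ¬ s.IsDisrupted A ∧ s.disrupted ≤ d then 1 else 0))).comp
      (measurable_snapshotAt c A t)
  rw [lintegral_tsum fun t => (hmeas t).aemeasurable]
  refine ENNReal.tsum_le_of_sum_range_le fun T => ?_
  rw [← lintegral_finsetSum _ fun t _ => hmeas t]
  have hdr := drift_pos c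
  -- The potential is only counted until more than `d` slots have been disrupted.
  have key := lintegral_potential_snapshot_le (c := c) (A := A)
    (f := fun s => if s.disrupted ≤ d then potential c s.state else 0)
    (gain := fun s => (min (s.disrupted + if s.IsDisrupted A then 1 else 0) (d + 1) : ℕ)
      - (min s.disrupted (d + 1) : ℕ))
    (cost := fun s _ => drift c *
      (if s.IsLive A ∧ ¬ s.IsDisrupted A ∧ s.disrupted ≤ d then 1 else 0))
    (fun s hs => by
      split_ifs
      · exact hs.potential_nonneg c
      · exact le_rfl)
    (fun s r => by positivity)
    (fun s => sub_nonneg.2 (by gcongr; omega))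
    (fun s hs => by
      by_cases hd : s.disrupted ≤ d
      · simp only [hd, and_true, if_true]
        have hle : ∀ x, (if (s.next c A x).disrupted ≤ d then potential c (s.next c A x).state
            else 0) ≤ potential c s.state +
              1 * s.change c A (broadcasts c (s.current A) x) := by
          intro x
          have h1 := hs.potential_next_le c A x
          have h2 := (hs.next c A x).potential_nonneg c
          split_ifs <;> linarith
        have hle' : ∀ x, (if (s.next c A x).disrupted ≤ d then potential c (s.next c A x).state
            else 0) + drift c * (if s.IsLive A ∧ ¬ s.IsDisrupted A then 1 else 0) ≤
              (potential c s.state + drift c * (if s.IsLive A ∧ ¬ s.IsDisrupted A then 1 else 0))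
              + 1 * s.change c A (broadcasts c (s.current A) x) := fun x => by
          linarith [hle x]
        refine (integral_mono (integrable_broadcasts c (s.current A) fun r =>
            (if (s.advance A r).disrupted ≤ d then potential c (s.advance A r).state else 0)
              + drift c * (if s.IsLive A ∧ ¬ s.IsDisrupted A then 1 else 0))
          (integrable_broadcasts c (s.current A) fun r =>
            (potential c s.state + drift c * (if s.IsLive A ∧ ¬ s.IsDisrupted A then 1 else 0))
              + 1 * s.change c A r) hle').trans ?_
        rw [integral_add_mul_change]
        have h3 := hs.integral_change_le hc A
        by_cases hdis : s.IsDisrupted A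
        · have hl := hdis.1
          have hm1 : min (s.disrupted + 1) (d + 1) = s.disrupted + 1 := by omega
          have hm2 : min s.disrupted (d + 1) = s.disrupted := by omega
          simp only [hdis, hl, if_true, not_true_eq_false, and_false, if_false, hm1, hm2] at h3 ⊢
          push_cast
          linarith
        · by_cases hl : s.IsLive A
          · simp only [hdis, hl, if_true, not_false_eq_true, and_true, if_false, add_zero,
              sub_self] at h3 ⊢
            linarith
          · simp only [hdis, hl, if_false, false_and, add_zero, sub_self] at h3 ⊢
            linarith
      · have hd' : ∀ x, ¬ (s.next c A x).disrupted ≤ d := by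
          intro x
          simp only [Snapshot.next, Snapshot.advance]
          omega
        simp only [hd, hd', and_false, if_false, mul_zero, add_zero, integral_zero, zero_add]
        exact sub_nonneg.2 (by gcongr; omega)) T
  refine (lintegral_mono fun ω => le_add_self).trans (key.trans ?_)
  refine add_le_add (le_of_eq ?_) ?_
  · simp [Snapshot.initial]
  · have hle : ∀ ω, ∑ t ∈ Finset.range T, ENNReal.ofReal
        ((min ((snapshotAt c A ω t).disrupted +
            if (snapshotAt c A ω t).IsDisrupted A then 1 else 0) (d + 1) : ℕ)
          - (min (snapshotAt c A ω t).disrupted (d + 1) : ℕ)) ≤ ENNReal.ofReal (d + 1) := by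
      intro ω
      have hsucc : ∀ t, (snapshotAt c A ω t).disrupted +
          (if (snapshotAt c A ω t).IsDisrupted A then 1 else 0) =
          (snapshotAt c A ω (t + 1)).disrupted := fun t => rfl
      rw [← ENNReal.ofReal_sum_of_nonneg fun t _ => sub_nonneg.2 (by gcongr; omega)]
      simp only [hsucc]
      rw [Finset.sum_range_sub fun t => ((min (snapshotAt c A ω t).disrupted (d + 1) : ℕ) : ℝ)]
      refine ENNReal.ofReal_le_ofReal ?_
      have h1 : ((min (snapshotAt c A ω T).disrupted (d + 1) : ℕ) : ℝ) ≤ ((d + 1 : ℕ) : ℝ) := by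
        exact_mod_cast min_le_right _ _
      have h2 : (0 : ℝ) ≤ ((min (snapshotAt c A ω 0).disrupted (d + 1) : ℕ) : ℝ) :=
        Nat.cast_nonneg _
      push_cast at h1 h2 ⊢
      linarith
    refine (lintegral_mono hle).trans ?_
    simp

theorem ae_finite_liveSlots {c : ℝ} (hc : 0 < c) {A : Adversary n} (hA : IsFiniteInstance c A) :
    ∀ᵐ ω ∂(coinMeasure n), (liveSlots c A ω).Finite := by
  classical
  have hmeas : ∀ d t, Measurable fun ω : Coins n => ENNReal.ofReal (drift c *
        (if (snapshotAt c A ω t).IsLive A ∧ ¬ (snapshotAt c A ω t).IsDisrupted A ∧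
          (snapshotAt c A ω t).disrupted ≤ d then 1 else 0)) := fun d t =>
    (measurable_of_countable fun s : Snapshot n => ENNReal.ofReal (drift c *
        (if s.IsLive A ∧ ¬ s.IsDisrupted A ∧ s.disrupted ≤ d then 1 else 0))).comp
      (measurable_snapshotAt c A t)
  have hfin : ∀ d : ℕ, ∀ᵐ ω ∂(coinMeasure n), ∑' t, ENNReal.ofReal (drift c *
        (if (snapshotAt c A ω t).IsLive A ∧ ¬ (snapshotAt c A ω t).IsDisrupted A ∧
          (snapshotAt c A ω t).disrupted ≤ d then 1 else 0)) < ∞ := fun d =>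
    ae_lt_top (Measurable.tsum (hmeas d))
      (ne_top_of_le_ne_top (by finiteness) (lintegral_tsum_live_le hc A d))
  filter_upwards [ae_all_iff.2 hfin, hA] with ω hω hAω
  have hset := ENNReal.finite_const_le_of_tsum_ne_top (hω (numDisrupted c A ω)).ne
    (ENNReal.ofReal_pos.2 (drift_pos c)).ne'
  refine (hset.union hAω.2).subset fun t ht => ?_
  by_cases hd : t ∈ disruptedSlots c A ω
  · exact Or.inr hd
  · refine Or.inl ?_
    have h1 : (snapshotAt c A ω t).IsLive A := (snapshotAt_isLive c A ω t).2 ht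
    have h2 : ¬ (snapshotAt c A ω t).IsDisrupted A := fun h =>
      hd ((snapshotAt_isDisrupted c A ω t).1 h)
    have h3 := snapshotAt_disrupted_le hAω.2 t
    simp [h1, h2, h3]

/-! ### The length of the execution on a logarithmic scale -/

/-- A function of the order of the squared logarithm that is concave on `[1, ∞)`. -/
def logSq (z : ℝ) : ℝ := (1 + Real.log z) ^ 2

theorem logSq_nonneg (z : ℝ) : 0 ≤ logSq z := sq_nonneg _

theorem logSq_mono {z z' : ℝ} (hz : 1 ≤ z) (h : z ≤ z') : logSq z ≤ logSq z' := by
  have h0 := Real.log_nonneg hz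
  have h1 := Real.log_le_log (by linarith) h
  unfold logSq
  gcongr

theorem one_add_log_div_anti {z z' : ℝ} (hz : 1 ≤ z) (h : z ≤ z') :
    (1 + Real.log z') / z' ≤ (1 + Real.log z) / z := by
  have hz0 : 0 < z := by linarith
  have hz0' : 0 < z' := by linarith
  have h0 := Real.log_nonneg hz
  have h1 := Real.log_le_sub_one_of_pos (div_pos hz0' hz0)
  rw [Real.log_div hz0'.ne' hz0.ne'] at h1
  rw [div_le_div_iff₀ hz0' hz0]
  have h2 := mul_le_mul_of_nonneg_right h1 hz0.le
  have h3 : (z' / z - 1) * z = z' - z := by field_simp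
  rw [h3] at h2
  nlinarith

theorem hasDerivAt_logSq {z : ℝ} (hz : 0 < z) :
    HasDerivAt logSq (2 * ((1 + Real.log z) / z)) z := by
  have h := ((Real.hasDerivAt_log hz.ne').const_add 1).pow 2
  refine HasDerivAt.congr_deriv h ?_
  norm_num
  ring

/-- The concavity of `logSq` on `[1, ∞)`. -/
theorem logSq_le_tangent {z z' : ℝ} (hz : 1 ≤ z) (hz' : 1 ≤ z') :
    logSq z' ≤ logSq z + 2 * ((1 + Real.log z) / z) * (z' - z) := by
  have hcont : ∀ a b : ℝ, 1 ≤ a → ContinuousOn logSq (Set.Icc a b) := fun a b ha x hx =>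
    (hasDerivAt_logSq (by linarith [hx.1])).continuousAt.continuousWithinAt
  rcases lt_trichotomy z z' with h | h | h
  · obtain ⟨ξ, hξ, hslope⟩ := exists_hasDerivAt_eq_slope logSq
      (fun x => 2 * ((1 + Real.log x) / x)) h (hcont z z' hz)
      fun x hx => hasDerivAt_logSq (by linarith [hx.1])
    have h1 := one_add_log_div_anti hz hξ.1.le
    have h2 : 0 < z' - z := by linarith
    rw [eq_div_iff h2.ne'] at hslope
    nlinarith
  · rw [h]; simp
  · obtain ⟨ξ, hξ, hslope⟩ := exists_hasDerivAt_eq_slope logSq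
      (fun x => 2 * ((1 + Real.log x) / x)) h (hcont z' z hz')
      fun x hx => hasDerivAt_logSq (by linarith [hx.1])
    have h1 := one_add_log_div_anti (by linarith [hξ.1] : 1 ≤ ξ) hξ.2.le
    have h2 : 0 < z - z' := by linarith
    rw [eq_div_iff h2.ne'] at hslope
    nlinarith

theorem one_add_log_div_le_logSq_sub {m : ℝ} (hm : 1 ≤ m) :
    (1 + Real.log m) / m ≤ logSq (m + 1) - logSq m := by
  have h0 := Real.log_nonneg hm
  have hm0 : 0 < m := by linarith
  have h1 : 1 / (2 * m) ≤ Real.log (m + 1) - Real.log m := by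
    have h := Real.one_sub_inv_le_log_of_pos (div_pos (by linarith : 0 < m + 1) hm0)
    rw [Real.log_div (by linarith) hm0.ne', inv_div] at h
    refine le_trans ?_ h
    rw [one_sub_div (by linarith), div_le_div_iff₀ (by linarith) (by linarith)]
    linarith
  have h2 : 0 ≤ Real.log (m + 1) - Real.log m := le_trans (by positivity) h1
  have h3 : (1 + Real.log m) / m = 2 * (1 + Real.log m) * (1 / (2 * m)) := by field_simp
  rw [h3]
  unfold logSq
  have h4 := mul_le_mul_of_nonneg_left h1 (by linarith : 0 ≤ 2 * (1 + Real.log m))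
  nlinarith

theorem logSq_mul_le {k z : ℝ} (hk : 1 ≤ k) (hz : 1 ≤ z) :
    logSq (k * z) ≤ logSq k * logSq z := by
  have h0 := Real.log_nonneg hk
  have h1 := Real.log_nonneg hz
  unfold logSq
  rw [Real.log_mul (by linarith) (by linarith), ← mul_pow]
  gcongr
  nlinarith

theorem accessSum_le_logSq {c : ℝ} (hc : 0 < c) (j : ℕ) :
    accessSum c j ≤ (1 / 2 + c) * logSq (j + 1) := by
  induction j with
  | zero =>
    have := logSq_nonneg ((0 : ℕ) + 1)
    simp only [accessSum, Finset.range_zero, Finset.sum_empty]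
    positivity
  | succ j ih =>
    rw [accessSum, Finset.sum_range_succ, ← accessSum]
    have hj : (1 : ℝ) ≤ (j : ℝ) + 1 := by linarith [(Nat.cast_nonneg j : (0 : ℝ) ≤ j)]
    have hlog := Real.log_nonneg hj
    have h1 := one_add_log_div_le_logSq_sub hj
    have h2 : (Status.active (j + 1) 0).dataProb ≤
        1 / 2 * ((1 + Real.log ((j : ℝ) + 1)) / ((j : ℝ) + 1)) := by
      simp only [Status.dataProb]
      rw [mul_div_assoc']
      push_cast
      gcongr
      linarith
    have h3 : (Status.active (j + 1) 0).controlProb c ≤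
        c * ((1 + Real.log ((j : ℝ) + 1)) / ((j : ℝ) + 1)) := by
      simp only [Status.controlProb]
      rw [mul_div_assoc']
      push_cast
      refine (min_le_right _ _).trans ?_
      gcongr
      exact max_le (by linarith) (by linarith)
    have h4 := mul_le_mul_of_nonneg_left h1 (by positivity : 0 ≤ 1 / 2 + c)
    push_cast
    linarith

/-- The number of slots of the execution, the potential, the number of packets and the number of
disrupted slots on a common scale: except for disrupted slots, this is a supermartingale. -/
def Snapshot.size (c : ℝ) (s : Snapshot n) : ℝ :=
  drift c * s.live + potential c s.state + (n + s.disrupted)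

theorem Snapshot.Valid.one_le_size {s : Snapshot n} (hs : s.Valid) (c : ℝ) (hn : 1 ≤ n) :
    1 ≤ s.size c ∧ (n : ℝ) + s.disrupted ≤ s.size c := by
  have h1 := hs.potential_nonneg c
  have h2 := (drift_pos c).le
  have h3 : (1 : ℝ) ≤ n := by exact_mod_cast hn
  have h4 : (0 : ℝ) ≤ drift c * s.live := by positivity
  have h5 : (0 : ℝ) ≤ s.disrupted := Nat.cast_nonneg _
  unfold Snapshot.size
  constructor <;> linarith

open Classical in
/-- By concavity and the drift of the potential, only disrupted slots increase the expectation of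
`logSq` of the size, and by no more than `6` times the increase of `logSq (n + D)`, where `D` is the
number of disrupted slots so far. -/
theorem Snapshot.Valid.integral_logSq_size_le {s : Snapshot n} (hs : s.Valid) {c : ℝ}
    (hc : 0 < c) (A : Adversary n) (hn : 1 ≤ n) :
    ∫ x, logSq ((s.next c A x).size c) ≤ logSq (s.size c) +
      6 * (logSq (n + (s.disrupted + if s.IsDisrupted A then 1 else 0 : ℕ))
        - logSq (n + s.disrupted)) := by
  obtain ⟨hZ, hm⟩ := hs.one_le_size c hn
  have hdr := drift_pos c
  have hdr1 := drift_le c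
  have hm1 : (1 : ℝ) ≤ n + s.disrupted := by
    have h3 : (1 : ℝ) ≤ n := by exact_mod_cast hn
    have h5 : (0 : ℝ) ≤ s.disrupted := Nat.cast_nonneg _
    linarith
  set Z := s.size c with hZdef
  set g := 2 * ((1 + Real.log Z) / Z) with hg
  have hg0 : 0 ≤ g := by
    have := Real.log_nonneg hZ
    positivity
  set a : ℝ := drift c * (if s.IsLive A then 1 else 0) + (if s.IsDisrupted A then 1 else 0) with ha
  have hle : ∀ x, logSq ((s.next c A x).size c) ≤
      (logSq Z + g * a) + g * s.change c A (broadcasts c (s.current A) x) := by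
    intro x
    have h1 := ((hs.next c A x).one_le_size c hn).1
    have h2 : (s.next c A x).size c ≤ Z + (a + s.change c A (broadcasts c (s.current A) x)) := by
      have := hs.potential_next_le c A x
      have e1 : (((s.next c A x).live : ℕ) : ℝ) = s.live + (if s.IsLive A then 1 else 0) := by
        simp only [Snapshot.next, Snapshot.advance]
        push_cast
        rfl
      have e2 : (((s.next c A x).disrupted : ℕ) : ℝ) =
          s.disrupted + (if s.IsDisrupted A then 1 else 0) := by
        simp only [Snapshot.next, Snapshot.advance]
        push_cast
        rfl
      rw [hZdef, Snapshot.size, Snapshot.size, e1, e2]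
      linarith
    refine (logSq_le_tangent hZ h1).trans ?_
    have h3 := mul_le_mul_of_nonneg_left h2 hg0
    rw [← hg]
    linarith
  refine (integral_mono (integrable_broadcasts c (s.current A) fun r =>
      logSq ((s.advance A r).size c)) (integrable_broadcasts c (s.current A) fun r =>
        (logSq Z + g * a) + g * s.change c A r) hle).trans ?_
  rw [integral_add_mul_change]
  have h4 := mul_le_mul_of_nonneg_left (hs.integral_change_le hc A) hg0
  have h5 : g ≤ 2 * (logSq ((n : ℝ) + s.disrupted + 1) - logSq (n + s.disrupted)) := by
    have h6 := one_add_log_div_anti hm1 hm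
    have h7 := one_add_log_div_le_logSq_sub hm1
    linarith
  by_cases hd : s.IsDisrupted A
  · simp only [hd, hd.1, if_true] at ha h4 ⊢
    push_cast
    rw [← add_assoc (n : ℝ)]
    rw [ha]
    nlinarith
  · simp only [hd, if_false, add_zero, sub_self, mul_zero, zero_sub] at ha h4 ⊢
    rw [ha]
    linarith

/-- A constant for the expected length of the execution on a logarithmic scale. -/
def logConstant (c : ℝ) : ℝ := logSq (successWeight c + 3) + 6

theorem logConstant_pos (c : ℝ) : 0 < logConstant c := by
  have := logSq_nonneg (successWeight c + 3)
  unfold logConstant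
  linarith

/-- The increases in the disrupted slots telescope. -/
theorem lintegral_logSq_size_le {c : ℝ} (hc : 0 < c) {A : Adversary n}
    (hA : IsFiniteInstance c A) (hn : 1 ≤ n) (T : ℕ) :
    ∫⁻ ω, ENNReal.ofReal (logSq ((snapshotAt c A ω T).size c)) ∂(coinMeasure n) ≤
      ENNReal.ofReal (logConstant c) *
        ∫⁻ ω, ENNReal.ofReal (logSq (n + numDisrupted c A ω)) ∂(coinMeasure n) := by
  classical
  have hn1 : (1 : ℝ) ≤ n := by exact_mod_cast hn
  have key := lintegral_potential_snapshot_le (c := c) (A := A)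
    (f := fun s => logSq (s.size c))
    (gain := fun s => 6 * (logSq (n + (s.disrupted + if s.IsDisrupted A then 1 else 0 : ℕ))
        - logSq (n + s.disrupted)))
    (cost := fun _ _ => 0)
    (fun s _ => logSq_nonneg _) (fun _ _ => le_rfl)
    (fun s => by
      have : logSq (n + s.disrupted) ≤
          logSq (n + (s.disrupted + if s.IsDisrupted A then 1 else 0 : ℕ)) := by
        refine logSq_mono ?_ ?_
        · linarith [(Nat.cast_nonneg s.disrupted : (0 : ℝ) ≤ s.disrupted)]
        · gcongr
          omega
      linarith)
    (fun s hs => by simpa using hs.integral_logSq_size_le hc A hn) T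
  refine (lintegral_mono fun ω => le_self_add).trans (key.trans ?_)
  have hinit : (Snapshot.initial : Snapshot n).size c ≤ (successWeight c + 3) * n := by
    have h := potential_initial_le (n := n) c
    have e1 : (Snapshot.initial : Snapshot n).live = 0 := rfl
    have e2 : (Snapshot.initial : Snapshot n).disrupted = 0 := rfl
    rw [Snapshot.size, e1, e2]
    push_cast
    linarith
  have h0 : logSq ((Snapshot.initial : Snapshot n).size c) ≤
      logSq (successWeight c + 3) * logSq n :=
    (logSq_mono (Snapshot.valid_initial.one_le_size c hn).1 hinit).trans
      (logSq_mul_le (by linarith [successWeight_pos c]) hn1)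
  have hgain : ∀ ω, ∑ t ∈ Finset.range T, ENNReal.ofReal
      (6 * (logSq (n + ((snapshotAt c A ω t).disrupted +
          if (snapshotAt c A ω t).IsDisrupted A then 1 else 0 : ℕ))
        - logSq (n + (snapshotAt c A ω t).disrupted))) ≤
      ENNReal.ofReal (6 * logSq (n + (snapshotAt c A ω T).disrupted)) := by
    intro ω
    have hsucc : ∀ t, (snapshotAt c A ω t).disrupted +
        (if (snapshotAt c A ω t).IsDisrupted A then 1 else 0) =
        (snapshotAt c A ω (t + 1)).disrupted := fun t => rfl
    simp only [hsucc]
    rw [← ENNReal.ofReal_sum_of_nonneg, ← Finset.mul_sum,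
      Finset.sum_range_sub fun t => logSq (n + (snapshotAt c A ω t).disrupted)]
    · refine ENNReal.ofReal_le_ofReal ?_
      linarith [logSq_nonneg (n + (snapshotAt c A ω 0).disrupted)]
    · intro t _
      rw [← hsucc]
      have : logSq (n + (snapshotAt c A ω t).disrupted) ≤ logSq (n +
          ((snapshotAt c A ω t).disrupted +
            if (snapshotAt c A ω t).IsDisrupted A then 1 else 0 : ℕ)) := by
        refine logSq_mono ?_ ?_
        · linarith [(Nat.cast_nonneg (snapshotAt c A ω t).disrupted :
            (0 : ℝ) ≤ (snapshotAt c A ω t).disrupted)]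
        · gcongr
          omega
      linarith
  have hae : ∀ᵐ ω ∂(coinMeasure n),
      ENNReal.ofReal (logSq (successWeight c + 3) * logSq n)
        + ENNReal.ofReal (6 * logSq (n + (snapshotAt c A ω T).disrupted)) ≤
      ENNReal.ofReal (logConstant c) * ENNReal.ofReal (logSq (n + numDisrupted c A ω)) := by
    filter_upwards [hA] with ω hω
    have hD : ((snapshotAt c A ω T).disrupted : ℝ) ≤ numDisrupted c A ω := by
      exact_mod_cast snapshotAt_disrupted_le hω.2 T
    have hD0 : (0 : ℝ) ≤ (snapshotAt c A ω T).disrupted := Nat.cast_nonneg _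
    have h1 : logSq n ≤ logSq (n + numDisrupted c A ω) := logSq_mono hn1 (by linarith)
    have h2 : logSq (n + (snapshotAt c A ω T).disrupted) ≤ logSq (n + numDisrupted c A ω) :=
      logSq_mono (by linarith) (by linarith)
    have h3 := logSq_nonneg (successWeight c + 3)
    have h4 := logSq_nonneg n
    rw [← ENNReal.ofReal_add (mul_nonneg h3 h4)
        (by linarith [logSq_nonneg (n + (snapshotAt c A ω T).disrupted)]),
      ← ENNReal.ofReal_mul (logConstant_pos c).le]
    refine ENNReal.ofReal_le_ofReal ?_
    unfold logConstant
    nlinarith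
  rw [← lintegral_const_mul' _ _ ENNReal.ofReal_ne_top]
  refine le_trans ?_ (lintegral_mono_ae hae)
  rw [lintegral_add_left measurable_const, lintegral_const, measure_univ, mul_one]
  exact add_le_add (ENNReal.ofReal_le_ofReal h0) (lintegral_mono hgain)

theorem logSq_le_log_sq {m : ℝ} (hm : 1 ≤ m) :
    logSq m ≤ (1 + 1 / Real.log 2) ^ 2 * Real.log (m + 1) ^ 2 := by
  have h2 : 0 < Real.log 2 := Real.log_pos one_lt_two
  have h3 : Real.log 2 ≤ Real.log (m + 1) := Real.log_le_log (by norm_num) (by linarith)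
  have h4 : Real.log m ≤ Real.log (m + 1) := Real.log_le_log (by linarith) (by linarith)
  have h5 : 1 ≤ 1 / Real.log 2 * Real.log (m + 1) := by
    rw [div_mul_eq_mul_div, one_mul, le_div_iff₀ h2]
    linarith
  have h6 := Real.log_nonneg hm
  rw [logSq, ← mul_pow]
  gcongr
  linarith

/-- A constant for the expected number of access attempts. -/
def accessConstant (c : ℝ) : ℝ :=
  5 * (1 / 2 + c) * logSq (1 + 1 / drift c) * (logConstant c * (1 + 1 / Real.log 2) ^ 2)

theorem lintegral_attempts_le_log_sq {c : ℝ} (hc : 0 < c) {A : Adversary n}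
    (hA : IsFiniteInstance c A) (hn : 1 ≤ n) (u : Fin n) :
    ∫⁻ ω, attempts c A ω u ∂(coinMeasure n) ≤ ENNReal.ofReal (accessConstant c) *
      ∫⁻ ω, ENNReal.ofReal (Real.log ((n : ℝ) + numDisrupted c A ω + 1) ^ 2)
        ∂(coinMeasure n) := by
  have hdr := drift_pos c
  have hn1 : (1 : ℝ) ≤ n := by exact_mod_cast hn
  have hK0 : 0 ≤ 5 * (1 / 2 + c) * logSq (1 + 1 / drift c) := by
    have := logSq_nonneg (1 + 1 / drift c)
    positivity
  refine lintegral_attempts_le hc A u fun T => ?_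
  have h1 : ∀ ω, ENNReal.ofReal (5 * accessSum c (snapshotAt c A ω T).live) ≤
      ENNReal.ofReal (5 * (1 / 2 + c) * logSq (1 + 1 / drift c)) *
        ENNReal.ofReal (logSq ((snapshotAt c A ω T).size c)) := by
    intro ω
    rw [← ENNReal.ofReal_mul hK0]
    refine ENNReal.ofReal_le_ofReal ?_
    have hv := valid_snapshotAt c A ω T
    set s := snapshotAt c A ω T
    have h2 := accessSum_le_logSq hc s.live
    have hZ := hv.one_le_size c hn
    have h3 : (s.live : ℝ) + 1 ≤ (1 + 1 / drift c) * s.size c := by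
      have h4 : drift c * s.live ≤ s.size c := by
        have := hv.potential_nonneg c
        have h5 : (0 : ℝ) ≤ s.disrupted := Nat.cast_nonneg _
        unfold Snapshot.size
        linarith
      have h6 : (s.live : ℝ) ≤ 1 / drift c * s.size c := by
        rw [div_mul_eq_mul_div, one_mul, le_div_iff₀ hdr]
        linarith
      linarith [hZ.1]
    have h7 : logSq ((s.live : ℝ) + 1) ≤ logSq (1 + 1 / drift c) * logSq (s.size c) :=
      (logSq_mono (by linarith [(Nat.cast_nonneg s.live : (0 : ℝ) ≤ s.live)]) h3).trans
        (logSq_mul_le (by have : 0 < 1 / drift c := by positivity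
                          linarith) hZ.1)
    nlinarith
  have h2 : ∀ ω, ENNReal.ofReal (logSq (n + numDisrupted c A ω)) ≤
      ENNReal.ofReal ((1 + 1 / Real.log 2) ^ 2) *
        ENNReal.ofReal (Real.log ((n : ℝ) + numDisrupted c A ω + 1) ^ 2) := by
    intro ω
    rw [← ENNReal.ofReal_mul (sq_nonneg _)]
    refine ENNReal.ofReal_le_ofReal (logSq_le_log_sq ?_)
    linarith [(Nat.cast_nonneg (numDisrupted c A ω) : (0 : ℝ) ≤ numDisrupted c A ω)]
  refine (lintegral_mono h1).trans ?_
  rw [lintegral_const_mul' _ _ ENNReal.ofReal_ne_top, accessConstant, ENNReal.ofReal_mul hK0,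
    ENNReal.ofReal_mul (logConstant_pos c).le,
    mul_assoc (ENNReal.ofReal (5 * (1 / 2 + c) * logSq (1 + 1 / drift c))),
    mul_assoc (ENNReal.ofReal (logConstant c))]
  refine mul_le_mul_right ((lintegral_logSq_size_le hc hA hn T).trans ?_) _
  refine mul_le_mul_right ?_ _
  rw [← lintegral_const_mul' _ _ ENNReal.ofReal_ne_top]
  exact lintegral_mono h2

end

/-! ### The length of the execution with constant probability -/

/-- A bound for `y₀ / max y y₀` after a decrease of `y` by `J`, in terms of `J` and `J ^ 4`. For
`J ≤ y / 2` it is the expansion of `1 / (y - J)` to first order with a quadratic remainder, and for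
`J > y / 2` the last term is at least `1`. -/
theorem div_max_sub_le {y₀ y J : ℝ} (hy₀ : 1 ≤ y₀) (hy : y₀ ≤ y) :
    y₀ / max (y - J) y₀ ≤
      y₀ / y + y₀ / y ^ 2 * J + 2 * y₀ / y ^ 3 * (1 + J ^ 4) + 16 / y ^ 4 * J ^ 4 := by
  have hy₀' : 0 < y₀ := by linarith
  have hy' : 0 < y := by linarith
  have hJ4 : 0 ≤ J ^ 4 := by positivity
  have hJ2 : J ^ 2 ≤ 1 + J ^ 4 := by nlinarith [sq_nonneg (J ^ 2 - 1), sq_nonneg (J ^ 2)]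
  rcases le_or_gt J (y / 2) with hJ | hJ
  · have hpos : 0 < y - J := by linarith
    have h1 : y₀ / max (y - J) y₀ ≤ y₀ / (y - J) :=
      div_le_div_of_nonneg_left hy₀'.le hpos (le_max_left _ _)
    have h2 : y₀ / (y - J) = y₀ / y + y₀ / y ^ 2 * J + y₀ / y ^ 2 * (J ^ 2 / (y - J)) := by
      field_simp
      ring
    have h3 : J ^ 2 / (y - J) ≤ 2 / y * (1 + J ^ 4) := by
      rw [div_mul_eq_mul_div, div_le_div_iff₀ hpos hy']
      nlinarith [sq_nonneg J]
    have h4 : y₀ / y ^ 2 * (J ^ 2 / (y - J)) ≤ 2 * y₀ / y ^ 3 * (1 + J ^ 4) := by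
      refine (mul_le_mul_of_nonneg_left h3 (by positivity)).trans (le_of_eq ?_)
      field_simp
    have h5 : 0 ≤ 16 / y ^ 4 * J ^ 4 := by positivity
    linarith
  · have h1 : y₀ / max (y - J) y₀ ≤ 1 := div_le_one_of_le₀ (le_max_right _ _) (by positivity)
    have h2 : (y / 2) ^ 4 ≤ J ^ 4 := by gcongr
    have h3 : 1 ≤ 16 / y ^ 4 * J ^ 4 := by
      rw [div_mul_eq_mul_div, le_div_iff₀ (by positivity)]
      linarith [show (y / 2) ^ 4 * 16 = y ^ 4 by ring]
    have hJ0 : 0 < J := by linarith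
    have h4 : 0 ≤ y₀ / y + y₀ / y ^ 2 * J + 2 * y₀ / y ^ 3 * (1 + J ^ 4) := by positivity
    linarith

/-- The scale beyond which the negative drift of the potential outweighs its fluctuations. -/
def fluctuation (c : ℝ) : ℝ := (2 + 18 * fourthMoment c) / (drift c / 2)

theorem fourthMoment_pos (c : ℝ) : 0 < fourthMoment c := by
  have := successWeight_pos c
  unfold fourthMoment
  positivity

theorem one_le_fluctuation (c : ℝ) : 1 ≤ fluctuation c := by
  have h1 := drift_pos c
  have h2 := drift_le c
  have h3 := fourthMoment_pos c
  unfold fluctuation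
  rw [le_div_iff₀ (by positivity)]
  linarith

theorem fluctuation_mul (c : ℝ) : fluctuation c * (drift c / 2) = 2 + 18 * fourthMoment c := by
  have h1 := drift_pos c
  unfold fluctuation
  field_simp

section

variable {n : ℕ}

/-- A supermartingale that bounds the length of the execution: disrupted slots are
counted with a negative weight. -/
def Snapshot.excess (c : ℝ) (s : Snapshot n) : ℝ :=
  drift c / 2 * s.live + potential c s.state - 2 * s.disrupted

/-- The distance of `Snapshot.excess` from a level that it is unlikely to reach. -/
def Snapshot.margin (c : ℝ) (s : Snapshot n) : ℝ :=
  (Snapshot.initial : Snapshot n).excess c + 2 * fluctuation c - s.excess c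

/-- The inverse of the margin is a supermartingale: beyond `fluctuation c`, the first-order gain
from the drift, of order `1 / y ^ 2`, outweighs the fourth-moment terms of `div_max_sub_le`. -/
theorem Snapshot.Valid.integral_div_margin_le {s : Snapshot n} (hs : s.Valid) {c : ℝ}
    (hc : 0 < c) (A : Adversary n) :
    ∫ x, fluctuation c / max ((s.next c A x).margin c) (fluctuation c) ≤
      fluctuation c / max (s.margin c) (fluctuation c) := by
  classical
  set y₀ := fluctuation c with hy₀def
  have hy₀ : 1 ≤ y₀ := one_le_fluctuation c
  have hdr := drift_pos c
  have hdr1 := drift_le c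
  have hconst : ∀ {a : ℝ} {f : SlotCoins n → ℝ}, Integrable f → (∀ x, f x ≤ a) → ∫ x, f x ≤ a :=
    fun {a f} hi h => (integral_mono hi (integrable_const a) h).trans (by simp)
  have hint := integrable_broadcasts c (s.current A) fun r =>
    y₀ / max ((s.advance A r).margin c) y₀
  rcases le_or_gt y₀ (s.margin c) with hy | hy
  swap
  · rw [max_eq_right hy.le, div_self (by linarith)]
    exact hconst hint fun x =>
      div_le_one_of_le₀ (le_max_right _ _) (le_max_of_le_right (by linarith))
  rw [max_eq_left hy]
  set y := s.margin c with hydef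
  have hy' : 0 < y := by linarith
  set δ : ℝ := drift c / 2 * (if s.IsLive A then 1 else 0) -
    2 * (if s.IsDisrupted A then 1 else 0) with hδ
  have hmargin : ∀ x, y - (s.change c A (broadcasts c (s.current A) x) + δ) ≤
      (s.next c A x).margin c := by
    intro x
    have := hs.potential_next_le c A x
    have e1 : (((s.next c A x).live : ℕ) : ℝ) = s.live + (if s.IsLive A then 1 else 0) := by
      simp only [Snapshot.next, Snapshot.advance]
      push_cast
      rfl
    have e2 : (((s.next c A x).disrupted : ℕ) : ℝ) =
        s.disrupted + (if s.IsDisrupted A then 1 else 0) := by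
      simp only [Snapshot.next, Snapshot.advance]
      push_cast
      rfl
    rw [hydef, Snapshot.margin, Snapshot.margin, Snapshot.excess, Snapshot.excess, Snapshot.excess,
      e1, e2]
    linarith
  have hle : ∀ x, y₀ / max ((s.next c A x).margin c) y₀ ≤
      y₀ / max (y - (s.change c A (broadcasts c (s.current A) x) + δ)) y₀ := by
    intro x
    exact div_le_div_of_nonneg_left (by linarith) (lt_max_of_lt_right (by linarith))
      (max_le_max_right _ (hmargin x))
  by_cases hl : s.IsLive A
  swap
  · refine hconst hint fun x => (hle x).trans ?_
    have hd : ¬ s.IsDisrupted A := fun h => hl h.1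
    have h0 : s.change c A (broadcasts c (s.current A) x) + δ = 0 := by
      rw [hδ]
      simp [Snapshot.change, hl, hd]
    rw [h0, sub_zero, max_eq_left hy]
  -- The expectations of the terms in the bound of `div_max_sub_le`.
  have hJ1 : (∫ x, s.change c A (broadcasts c (s.current A) x)) + δ ≤ -(drift c / 2) := by
    have h := hs.integral_change_le hc A
    rw [hδ]
    by_cases hd : s.IsDisrupted A <;> simp only [hl, hd, if_true, if_false] at h ⊢ <;> linarith
  have hδ3 : |δ| ≤ 3 := by
    rw [hδ, abs_le]
    by_cases hd : s.IsDisrupted A <;> simp only [hl, hd, if_true, if_false] <;>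
      constructor <;> linarith
  have hchange : ∀ r, s.change c A r = potentialChange c (A s.hist) (s.current A) r := by
    intro r
    simp [Snapshot.change, hl]
  have hJ4 : ∫ x, (s.change c A (broadcasts c (s.current A) x) + δ) ^ 4 ≤ fourthMoment c := by
    simp only [hchange]
    exact integral_potentialChange_pow_le hc _ (hs.current A) hδ3
  have hm := fourthMoment_pos c
  set m := fourthMoment c
  have i1 := integrable_broadcasts c (s.current A) (s.change c A)
  have i2 := integrable_broadcasts c (s.current A) fun r => (s.change c A r + δ) ^ 4
  -- The term `0 * 0` fills a place in `integral_linear_combination`.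
  have hpt : ∀ x, y₀ / max ((s.next c A x).margin c) y₀ ≤
      y₀ / y ^ 2 * s.change c A (broadcasts c (s.current A) x)
      + (2 * y₀ / y ^ 3 + 16 / y ^ 4) * (s.change c A (broadcasts c (s.current A) x) + δ) ^ 4
      + 0 * 0 + (y₀ / y + y₀ / y ^ 2 * δ + 2 * y₀ / y ^ 3) := by
    intro x
    refine (hle x).trans ((div_max_sub_le hy₀ hy).trans (le_of_eq ?_))
    ring
  refine (integral_mono hint (integrable_broadcasts c (s.current A) fun r =>
      y₀ / y ^ 2 * s.change c A r + (2 * y₀ / y ^ 3 + 16 / y ^ 4) * (s.change c A r + δ) ^ 4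
      + 0 * 0 + (y₀ / y + y₀ / y ^ 2 * δ + 2 * y₀ / y ^ 3)) hpt).trans ?_
  rw [integral_linear_combination (f₃ := fun _ => 0) i1 i2 (integrable_const _)]
  have h1 := mul_le_mul_of_nonneg_left hJ1 (by positivity : 0 ≤ y₀ / y ^ 2)
  have h2 := mul_le_mul_of_nonneg_left hJ4
    (by positivity : 0 ≤ 2 * y₀ / y ^ 3 + 16 / y ^ 4)
  have h3 : 2 * y₀ / y ^ 3 ≤ 2 / y ^ 2 := by
    rw [div_le_div_iff₀ (by positivity) (by positivity)]
    nlinarith [mul_le_mul_of_nonneg_left hy (by positivity : 0 ≤ 2 * y ^ 2)]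
  have h4 : 16 / y ^ 4 ≤ 16 / y ^ 2 := by
    have : (1 : ℝ) ≤ y := by linarith
    gcongr
    norm_num
  have h5 : y₀ / y ^ 2 * (drift c / 2) = 2 / y ^ 2 + 18 / y ^ 2 * m := by
    have := fluctuation_mul c
    rw [div_mul_eq_mul_div, this]
    ring
  have h6 := mul_le_mul_of_nonneg_right (add_le_add h3 h4) hm.le
  have h7 : (2 / y ^ 2 + 16 / y ^ 2) * m = 18 / y ^ 2 * m := by ring
  linarith

/-- A constant that the ratio of the length of the execution to the number of packets and disrupted
slots exceeds with probability at most `1 / 2`. -/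
def lengthConstant (c : ℝ) : ℝ := (successWeight c + 4 + fluctuation c) / (drift c / 2)

theorem lengthConstant_pos (c : ℝ) : 0 < lengthConstant c := by
  have h1 := drift_pos c
  have h2 := successWeight_pos c
  have h3 := one_le_fluctuation c
  unfold lengthConstant
  positivity

/-- An execution that is too long uses up its margin. The inverse of the margin, in units of
`fluctuation c`, is `1 / 2` at the beginning, and Markov's inequality applies. -/
theorem measure_lt_live_le {c : ℝ} (hc : 0 < c) (A : Adversary n) (hn : 1 ≤ n) (T : ℕ) :
    coinMeasure n {ω | lengthConstant c * (n + (snapshotAt c A ω T).disrupted) <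
      (snapshotAt c A ω T).live} ≤ ENNReal.ofReal (1 / 2) := by
  have hn1 : (1 : ℝ) ≤ n := by exact_mod_cast hn
  have hdr := drift_pos c
  have hα := successWeight_pos c
  have hy₀ := one_le_fluctuation c
  have hpos : ∀ s : Snapshot n, 0 ≤ fluctuation c / max (s.margin c) (fluctuation c) := fun s =>
    div_nonneg (by linarith) (le_max_of_le_right (by linarith))
  have key := lintegral_potential_snapshot_le (c := c) (A := A)
    (f := fun s => fluctuation c / max (s.margin c) (fluctuation c))
    (gain := fun _ => 0) (cost := fun _ _ => 0)
    (fun s _ => hpos s) (fun _ _ => le_rfl) (fun _ => le_rfl)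
    (fun s hs => by simpa using hs.integral_div_margin_le hc A) T
  have hinit : fluctuation c / max ((Snapshot.initial : Snapshot n).margin c) (fluctuation c) =
      1 / 2 := by
    have h1 : (Snapshot.initial : Snapshot n).margin c = 2 * fluctuation c := by
      unfold Snapshot.margin; ring
    rw [h1, max_eq_left (by linarith)]
    field_simp
  rw [hinit] at key
  simp only [ENNReal.ofReal_zero, Finset.sum_const_zero, add_zero, lintegral_zero] at key
  have hmeas : Measurable fun ω => ENNReal.ofReal
      (fluctuation c / max ((snapshotAt c A ω T).margin c) (fluctuation c)) :=
    (measurable_of_countable fun s : Snapshot n => ENNReal.ofReal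
      (fluctuation c / max (s.margin c) (fluctuation c))).comp (measurable_snapshotAt c A T)
  refine le_trans ?_ ((mul_meas_ge_le_lintegral hmeas 1).trans key)
  rw [one_mul]
  refine measure_mono fun ω hω => ?_
  rw [Set.mem_ofPred_eq] at hω
  have hv := valid_snapshotAt c A ω T
  change 1 ≤ ENNReal.ofReal
    (fluctuation c / max ((snapshotAt c A ω T).margin c) (fluctuation c))
  set s := snapshotAt c A ω T
  have h1 : s.margin c ≤ fluctuation c := by
    have h2 := hv.potential_nonneg c
    have h3 := potential_initial_le (n := n) c
    have e1 : (Snapshot.initial : Snapshot n).live = 0 := rfl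
    have e2 : (Snapshot.initial : Snapshot n).disrupted = 0 := rfl
    rw [lengthConstant, div_mul_eq_mul_div, div_lt_iff₀ (by positivity)] at hω
    have h5 : (0 : ℝ) ≤ s.disrupted := Nat.cast_nonneg _
    unfold Snapshot.margin Snapshot.excess
    rw [e1, e2]
    push_cast
    nlinarith [mul_nonneg hα.le h5, mul_nonneg (by linarith : 0 ≤ fluctuation c) h5]
  rw [max_eq_right h1, div_self (by linarith), ENNReal.ofReal_one]

theorem exists_snapshotAt_eq {c : ℝ} {A : Adversary n} {ω : Coins n}
    (hL : (liveSlots c A ω).Finite) :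
    ∃ T, ∀ t ≥ T, (snapshotAt c A ω t).live = (liveSlots c A ω).ncard ∧
      (snapshotAt c A ω t).disrupted = numDisrupted c A ω := by
  classical
  have hD : (disruptedSlots c A ω).Finite := hL.subset fun t ht => ht.1
  obtain ⟨T₁, h₁⟩ := exists_forall_filter_range_card_eq hL
  obtain ⟨T₂, h₂⟩ := exists_forall_filter_range_card_eq hD
  refine ⟨max T₁ T₂, fun t ht => ⟨?_, ?_⟩⟩
  · rw [snapshotAt_live_eq_card, h₁ t (le_trans (le_max_left _ _) ht)]
  · rw [snapshotAt_disrupted_eq_card, h₂ t (le_trans (le_max_right _ _) ht)]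
    rfl

theorem measurableSet_lt_live (c : ℝ) (A : Adversary n) (T : ℕ) :
    MeasurableSet {ω | lengthConstant c * (n + (snapshotAt c A ω T).disrupted) <
      (snapshotAt c A ω T).live} :=
  measurable_snapshotAt c A T
    (MeasurableSet.of_discrete
      (s := {s : Snapshot n | lengthConstant c * (n + s.disrupted) < s.live}))

/-- The event that, from some slot on, the number of live slots so far exceeds `lengthConstant c`
times the number of packets and of slots disrupted so far. -/
def longEvent (c : ℝ) (A : Adversary n) : Set (Coins n) :=
  ⋃ N : ℕ, ⋂ T ≥ N, {ω | lengthConstant c * (n + (snapshotAt c A ω T).disrupted) <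
    (snapshotAt c A ω T).live}

theorem measurableSet_longEvent (c : ℝ) (A : Adversary n) : MeasurableSet (longEvent c A) :=
  MeasurableSet.iUnion fun _ => MeasurableSet.iInter fun T =>
    MeasurableSet.iInter fun _ => measurableSet_lt_live c A T

theorem measure_longEvent_le {c : ℝ} (hc : 0 < c) (A : Adversary n) (hn : 1 ≤ n) :
    coinMeasure n (longEvent c A) ≤ ENNReal.ofReal (1 / 2) := by
  have hmono : Monotone fun N : ℕ => ⋂ T ≥ N, {ω : Coins n |
      lengthConstant c * (n + (snapshotAt c A ω T).disrupted) < (snapshotAt c A ω T).live} :=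
    fun N N' hN => Set.biInter_subset_biInter_left fun T (hT : N' ≤ T) => hN.trans hT
  rw [longEvent, hmono.measure_iUnion]
  exact iSup_le fun N => (measure_mono (Set.biInter_subset_of_mem le_rfl)).trans
    (measure_lt_live_le hc A hn N)

theorem live_le_of_notMem_longEvent {c : ℝ} {A : Adversary n} {ω : Coins n}
    (hL : (liveSlots c A ω).Finite) (h : ω ∉ longEvent c A) :
    ((liveSlots c A ω).ncard : ℝ) ≤ lengthConstant c * (n + numDisrupted c A ω) := by
  by_contra hcon
  rw [not_le] at hcon
  obtain ⟨T, hT⟩ := exists_snapshotAt_eq hL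
  refine h (Set.mem_iUnion.2 ⟨T, Set.mem_iInter₂.2 fun t ht => ?_⟩)
  rw [Set.mem_ofPred_eq, (hT t ht).1, (hT t ht).2]
  exact hcon

/-! ### Successful slots and waste -/

theorem statusAt_succ (c : ℝ) (A : Adversary n) (ω : Coins n) (t : ℕ) (u : Fin n) :
    statusAt c A ω (t + 1) u =
      step (decisionAt c A ω t) (slotState c A ω t) (recordAt c A ω t) u := rfl

theorem statusAt_eq_of_not_live {c : ℝ} {A : Adversary n} {ω : Coins n} {t : ℕ} {u : Fin n}
    (h : t ∉ liveSlots c A ω) : statusAt c A ω t u = .pending ∨ statusAt c A ω t u = .done := by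
  have hu : ¬ (slotState c A ω t u).IsLive := fun hu => h ⟨u, hu⟩
  change ¬ (arrive (config c A ω t).1 (decisionAt c A ω t) u).IsLive at hu
  change (config c A ω t).1 u = .pending ∨ (config c A ω t).1 u = .done
  rcases hst : (config c A ω t).1 u with _ | _ | ⟨s, e⟩ | _
  · exact Or.inl rfl
  · simp [arrive, hst, Status.IsLive] at hu
  · simp [arrive, hst, Status.IsLive] at hu
  · exact Or.inr rfl

theorem statusAt_ne_pending_succ {c : ℝ} {A : Adversary n} {ω : Coins n} {t : ℕ} {u : Fin n}
    (h : statusAt c A ω t u ≠ .pending) : statusAt c A ω (t + 1) u ≠ .pending := by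
  classical
  rw [statusAt_succ]
  change (config c A ω t).1 u ≠ .pending at h
  have hslot : slotState c A ω t u = (config c A ω t).1 u := by
    rcases hst : (config c A ω t).1 u with _ | _ | ⟨s, e⟩ | _
    · exact absurd hst h
    all_goals simp [slotState, arrive, hst]
  rcases hst : slotState c A ω t u with _ | _ | ⟨s, e⟩ | _
  · rw [hslot] at hst; exact absurd hst h
  · rw [step_inactive hst]; split_ifs <;> simp
  · rw [step_active hst]; split_ifs <;> simp
  · rw [step_done hst]; simp

theorem exists_statusAt_eq_done {c : ℝ} {A : Adversary n} {ω : Coins n}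
    (hL : (liveSlots c A ω).Finite) {u : Fin n}
    (hu : ∃ t, statusAt c A ω t u ≠ Status.pending) :
    ∃ t, statusAt c A ω t u = Status.done := by
  obtain ⟨t₀, ht₀⟩ := hu
  obtain ⟨T, hT⟩ := hL.bddAbove
  have hne : ∀ k, statusAt c A ω (t₀ + k) u ≠ .pending := by
    intro k
    induction k with
    | zero => exact ht₀
    | succ k ih => exact statusAt_ne_pending_succ ih
  refine ⟨t₀ + (T + 1), ?_⟩
  have hnot : t₀ + (T + 1) ∉ liveSlots c A ω := fun h => by
    have := hT h
    omega
  exact (statusAt_eq_of_not_live hnot).resolve_left (hne _)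

/-- A packet that is transmitted successfully is so in some slot of the execution. -/
theorem exists_succeeds {c : ℝ} {A : Adversary n} {ω : Coins n} {u : Fin n}
    (hu : ∃ t, statusAt c A ω t u = Status.done) :
    ∃ t ∈ liveSlots c A ω, (recordAt c A ω t).data = {u} := by
  classical
  have hfind := Nat.find_spec hu
  have hmin := fun t => Nat.find_min hu (m := t)
  obtain ⟨t, ht⟩ : ∃ t, Nat.find hu = t + 1 := by
    refine Nat.exists_eq_succ_of_ne_zero fun h0 => ?_
    rw [h0] at hfind
    simp [statusAt, config] at hfind
  rw [ht] at hfind hmin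
  have hprev := hmin t (Nat.lt_succ_self t)
  rw [statusAt_succ] at hfind
  rcases hst : slotState c A ω t u with _ | _ | ⟨s, e⟩ | _
  · rw [step_pending hst] at hfind; simp at hfind
  · rw [step_inactive hst] at hfind; split_ifs at hfind
  · rw [step_active hst] at hfind
    split_ifs at hfind with hs
    exact ⟨t, ⟨u, by rw [hst]; trivial⟩, hs.2⟩
  · refine absurd ?_ hprev
    change (config c A ω t).1 u = .done
    rcases hc : (config c A ω t).1 u with _ | _ | ⟨s, e⟩ | _
    · simp only [slotState, arrive, hc] at hst
      split_ifs at hst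
    · simp [slotState, arrive, hc] at hst
    · simp [slotState, arrive, hc] at hst
    · rfl

/-- Neither the disrupted slots nor the slots with exactly one broadcast are wasted. -/
theorem ncard_wastedSlots_add_le {c : ℝ} {A : Adversary n} {ω : Coins n}
    (hL : (liveSlots c A ω).Finite) (hdone : ∀ u, ∃ t, statusAt c A ω t u = Status.done) :
    (wastedSlots c A ω).ncard + n ≤ (liveSlots c A ω).ncard ∧
      (wastedSlots c A ω).ncard + numDisrupted c A ω ≤ (liveSlots c A ω).ncard := by
  have hW : (wastedSlots c A ω).Finite := hL.subset fun t ht => ht.1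
  have hD : (disruptedSlots c A ω).Finite := hL.subset fun t ht => ht.1
  constructor
  · choose t htl ht using fun u => exists_succeeds (hdone u)
    have hinj : Function.Injective t := fun u v huv => by
      have := ht u
      rw [huv, ht v] at this
      simpa using this.symm
    have hcard : (Set.range t).ncard = n := by
      rw [← Set.image_univ, Set.ncard_image_of_injective _ hinj, Set.ncard_univ, Nat.card_fin]
    have hdisj : Disjoint (wastedSlots c A ω) (Set.range t) := by
      refine Set.disjoint_left.2 ?_
      rintro _ hw ⟨u, rfl⟩
      rcases hw.2.2 with h | h <;> rw [ht u] at h <;> simp at h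
    calc (wastedSlots c A ω).ncard + n
        = (wastedSlots c A ω ∪ Set.range t).ncard := by
          rw [Set.ncard_union_eq hdisj hW (Set.finite_range t), hcard]
      _ ≤ _ := Set.ncard_le_ncard (Set.union_subset (fun i hi => hi.1)
          (Set.range_subset_iff.2 htl)) hL
  · have hdisj : Disjoint (wastedSlots c A ω) (disruptedSlots c A ω) :=
      Set.disjoint_left.2 fun i hi => hi.2.1
    calc (wastedSlots c A ω).ncard + numDisrupted c A ω
        = (wastedSlots c A ω ∪ disruptedSlots c A ω).ncard := by
          rw [Set.ncard_union_eq hdisj hW hD]; rfl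
      _ ≤ _ := Set.ncard_le_ncard (Set.union_subset (fun i hi => hi.1) fun i hi => hi.1) hL

theorem waste_le_one (c : ℝ) (A : Adversary n) {ω : Coins n} (hL : (liveSlots c A ω).Finite) :
    waste c A ω ≤ 1 := by
  have hsub : wastedSlots c A ω ⊆ liveSlots c A ω := fun i hi => hi.1
  exact div_le_one_of_le₀ (Nat.cast_le.2 (Set.ncard_le_ncard hsub hL)) (Nat.cast_nonneg _)

theorem waste_le_of_notMem_longEvent {c : ℝ} {A : Adversary n} (hn : 1 ≤ n) {ω : Coins n}
    (hL : (liveSlots c A ω).Finite) (hdone : ∀ u, ∃ t, statusAt c A ω t u = Status.done)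
    (h : ω ∉ longEvent c A) : waste c A ω ≤ 1 - 1 / (2 * lengthConstant c) := by
  obtain ⟨h1, h2⟩ := ncard_wastedSlots_add_le hL hdone
  have h3 := live_le_of_notMem_longEvent hL h
  have hK := lengthConstant_pos c
  have h1' : ((wastedSlots c A ω).ncard : ℝ) + n ≤ (liveSlots c A ω).ncard := by exact_mod_cast h1
  have h2' : ((wastedSlots c A ω).ncard : ℝ) + numDisrupted c A ω ≤ (liveSlots c A ω).ncard := by
    exact_mod_cast h2
  have hn1 : (1 : ℝ) ≤ n := by exact_mod_cast hn
  have hW : (0 : ℝ) ≤ (wastedSlots c A ω).ncard := Nat.cast_nonneg _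
  have hLpos : (0 : ℝ) < (liveSlots c A ω).ncard := by linarith
  unfold waste
  rw [div_le_iff₀ hLpos, sub_mul, one_mul]
  have h4 : 1 / (2 * lengthConstant c) * ((liveSlots c A ω).ncard : ℝ) ≤
      (n + numDisrupted c A ω) / 2 := by
    rw [div_mul_eq_mul_div, one_mul, div_le_div_iff₀ (by positivity) two_pos]
    linarith
  linarith

theorem integral_waste_le {c : ℝ} (hc : 0 < c) {A : Adversary n} (hn : 1 ≤ n)
    (hL : ∀ᵐ ω ∂(coinMeasure n), (liveSlots c A ω).Finite)
    (hdone : ∀ᵐ ω ∂(coinMeasure n), ∀ u, ∃ t, statusAt c A ω t u = Status.done) :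
    ∫ ω, waste c A ω ∂(coinMeasure n) ≤ 1 - 1 / (4 * lengthConstant c) := by
  have hK := lengthConstant_pos c
  set g : Coins n → ℝ := fun ω => (1 - 1 / (2 * lengthConstant c)) +
    (longEvent c A).indicator (fun _ => 1 / (2 * lengthConstant c)) ω with hg
  have hind : Integrable ((longEvent c A).indicator
      fun _ => 1 / (2 * lengthConstant c)) (coinMeasure n) :=
    (integrable_const _).indicator (measurableSet_longEvent c A)
  have hgint : Integrable g (coinMeasure n) := (integrable_const _).add hind
  have hle : ∀ᵐ ω ∂(coinMeasure n), waste c A ω ≤ g ω := by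
    filter_upwards [hL, hdone] with ω hω hω'
    by_cases hmem : ω ∈ longEvent c A
    · rw [hg]
      simp only [Set.indicator_of_mem hmem, sub_add_cancel]
      exact waste_le_one c A hω
    · rw [hg]
      simp only [Set.indicator_of_notMem hmem, add_zero]
      exact waste_le_of_notMem_longEvent hn hω hω' hmem
  have hnonneg : ∀ᵐ ω ∂(coinMeasure n), 0 ≤ waste c A ω :=
    Filter.Eventually.of_forall fun ω => div_nonneg (Nat.cast_nonneg _) (Nat.cast_nonneg _)
  refine (integral_mono_of_nonneg hnonneg hgint hle).trans ?_
  rw [hg, integral_add (integrable_const _) hind, integral_indicator_const _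
    (measurableSet_longEvent c A), integral_const]
  simp only [probReal_univ, smul_eq_mul]
  have hprob : (coinMeasure n).real (longEvent c A) ≤ 1 / 2 :=
    ENNReal.toReal_le_of_le_ofReal (by norm_num) (measure_longEvent_le hc A hn)
  have h1 := mul_le_mul_of_nonneg_right hprob
    (by positivity : 0 ≤ 1 / (2 * lengthConstant c))
  have h2 : 1 / 2 * (1 / (2 * lengthConstant c)) = 1 / (4 * lengthConstant c) := by
    field_simp
    norm_num
  have h3 : 1 / (2 * lengthConstant c) =
      1 / (4 * lengthConstant c) + 1 / (4 * lengthConstant c) := by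
    field_simp
    norm_num
  linarith

end

end ReBackoff

end

theorem mainTheorem1 :
    ∀ c : ℝ, 0 < c →
      ∃ ε : ℝ, 0 < ε ∧ ∃ C : ℝ≥0,
        ∀ (n : ℕ), 1 ≤ n → ∀ A : ReBackoff.Adversary n, ReBackoff.IsFiniteInstance c A →
          (∀ᵐ ω ∂(ReBackoff.coinMeasure n),
            ∀ u, ∃ t, ReBackoff.statusAt c A ω t u = ReBackoff.Status.done) ∧
          (∫ ω, ReBackoff.waste c A ω ∂(ReBackoff.coinMeasure n)) ≤ 1 - ε ∧
          ∀ u : Fin n,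
            (∫⁻ ω, ReBackoff.attempts c A ω u ∂(ReBackoff.coinMeasure n)) ≤
              (C : ℝ≥0∞) * ∫⁻ ω, ENNReal.ofReal
                (Real.log ((n : ℝ) + (ReBackoff.numDisrupted c A ω : ℝ) + 1) ^ 2)
                ∂(ReBackoff.coinMeasure n) := by
  intro c hc
  have hK := ReBackoff.lengthConstant_pos c
  refine ⟨1 / (4 * ReBackoff.lengthConstant c), by positivity,
    (ReBackoff.accessConstant c).toNNReal, fun n hn A hA => ?_⟩
  have hL := ReBackoff.ae_finite_liveSlots hc hA
  have hdone : ∀ᵐ ω ∂(ReBackoff.coinMeasure n),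
      ∀ u, ∃ t, ReBackoff.statusAt c A ω t u = ReBackoff.Status.done := by
    filter_upwards [hL, hA] with ω hω hAω u
    exact ReBackoff.exists_statusAt_eq_done hω (hAω.1 u)
  exact ⟨hdone, ReBackoff.integral_waste_le hc hn hL hdone,
    fun u => ReBackoff.lintegral_attempts_le_log_sq hc hA hn u⟩
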